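/- **Setting.** Let $n,m\ge 1$, $p\ge 0$ be integers, $N=nm$, and let $f_{i,j}:\mathbb R^p\to\mathbb R$ ($1\le i\le n$, $1\le j\le m$) be differentiable, $f_i=\frac1m\sum_{j=1}^m f_{i,j}$, $F=\frac1n\sum_{i=1}^n f_i$, with $F^*:=\inf F>-\infty$ and, for some $L>0$, $$\tfrac1m\sum_{j=1}^m\|\nabla f_{i,j}(x)-\nabla f_{i,j}(y)\|^2\le L^2\|x-y\|^2\qquad\text{for all } i \text{ and all } x,y\in\mathbb R^p.$$ Let $W=(w_{ir})\in\mathbb R^{n\times n}$ be a nonnegative, primitive, doubly stochastic matrix with positive diagonal, supported on a directed graph on the $n$ nodes that has all self-loops, and let $\lambda=\|W-\frac1n\mathbf 1\mathbf 1^\top\|$ (spectral norm). For a starting point $x^0\in\mathbb R^p$ put $\Delta=L(F(x^0)-F^*)+\frac1n\sum_{i=1}^n\|\nabla f_i(x^0)\|^2$. **Algorithm (GT-SARAH).** The parameters are a step-size $\alpha>0$, an inner-loop length $q\ge1$ and a minibatch size $B\in\{1,\dots,m\}$. Start with $x_i^{0,1}=x^0$, $y_i^{0,1}=0$, $v_i^{-1,1}=0$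 for all $i$. In each outer loop $s=1,2,\dots$, for $t=0,1,\dots,q$ and every node $i$, put $$v_i^{0,s}=\tfrac1m\sum_{j=1}^m\nabla f_{i,j}(x_i^{0,s}),\qquad v_i^{t,s}=v_i^{t-1,s}+\tfrac1B\sum_{l=1}^B\bigl(\nabla f_{i,\tau_{i,l}^{t,s}}(x_i^{t,s})-\nabla f_{i,\tau_{i,l}^{t,s}}(x_i^{t-1,s})\bigr)\quad(t\ge1),$$ $$y_i^{t+1,s}=\sum_{r=1}^n w_{ir}y_r^{t,s}+v_i^{t,s}-v_i^{t-1,s},\qquad x_i^{t+1,s}=\sum_{r=1}^n w_{ir}x_r^{t,s}-\alpha y_i^{t+1,s},$$ and then $x_i^{0,s+1}=x_i^{q+1,s}$, $y_i^{0,s+1}=y_i^{q+1,s}$, $v_i^{-1,s+1}=v_i^{q,s}$. The indices $\tau_{i,l}^{t,s}$ are independent and uniform on $\{1,\dots,m\}$. One outer loop costs $n(m+2qB)$ component gradient computations across all nodes and $q+1$ rounds of communication. With $\bar x^{t,s}=\frac1n\sum_i x_i^{t,s}$, the algorithm *finds an $\epsilon$-accurate stationary point in $S\ge1$ outer loops*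 if $$\frac1{S(q+1)}\sum_{s=1}^S\sum_{t=0}^q\frac1n\sum_{i=1}^n\mathbb E\bigl[\|\nabla F(x_i^{t,s})\|^2+L^2\|x_i^{t,s}-\bar x^{t,s}\|^2\bigr]\le\epsilon^2 .$$ We say that its gradient (resp. communication) *complexity is at most $T$* if this holds for every $S\ge1$ whose total number of component gradient computations (resp. rounds of communication) is at least $T$, and it holds for some $S\ge1$ for which that number is at most the maximum of $T$ and the cost of a single outer loop. For $1\le B\le m$ let $$h_B=\max\Bigl\{\tfrac{nB}{(1-\lambda)^2},\,N^{1/2},\,\tfrac{m^{1/3}n^{2/3}B^{1/3}}{1-\lambda}\Bigr\},\qquad k_B=\max\Bigl\{\tfrac1{(1-\lambda)^2},\,\tfrac{m^{1/2}}{n^{1/2}B},\,\tfrac{m^{1/3}}{n^{1/3}B^{2/3}(1-\lambda)}\Bigr\},$$ $$\mu_B=\min\Bigl\{(1-\lambda)^2,\,\tfrac{n^{1/2}B}{m^{1/2}},\,\tfrac{n^{1/3}B^{2/3}(1-\lambda)}{m^{1/3}}\Bigr\};$$ up to universal constants, $h_B\Delta/\epsilon^2$ and $k_B\Delta/\epsilon^2$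 are the gradient and communication complexity bounds of the algorithm for the minibatch size $B$. **Statement.** For all constants $0<c_1\le c_2$ there is $a_0>0$ such that for every $a_1\in(0,a_0]$ there is $K>0$ (so $a_0$ and $K$ are independent of all the problem data: $n$, $m$, $p$, $f_{i,j}$, $L$, $W$, $x^0$, $\epsilon$, and of $B$, $q$, $\alpha$) such that the following holds for all data as above, all $\epsilon>0$, all $B\in\{1,\dots,m\}$ and all $q$, $\alpha$ with $$c_1\tfrac mB\le q\le c_2\tfrac mB,\qquad a_1\tfrac{\mu_B}L\le\alpha\le a_0\tfrac{\mu_B}L .$$ (i) Let $R=\max\{m^{1/2}n^{-1/2}(1-\lambda)^3,1\}$. If $B\le\lfloor R\rfloor$, then the gradient complexity is at most $$K\max\Bigl\{\tfrac n{(1-\lambda)^2},\,N^{1/2},\,\tfrac{m^{1/3}n^{2/3}}{1-\lambda}\Bigr\}\frac\Delta{\epsilon^2},$$ and this is the best possible bound: the maximum equals $h_B$ and is at most $h_{B'}$ for every $B'\in\{1,\dots,m\}$. If $B=\lfloor R\rfloor$, then the communication complexity is at most $$K\max\Bigl\{\tfrac1{(1-\lambda)^2},\,\min\Bigl\{\tfrac{m^{1/2}}{n^{1/2}},\tfrac1{(1-\lambda)^3}\Bigr\},\,\min\Bigl\{\tfrac{m^{1/3}}{n^{1/3}(1-\lambda)},\tfrac1{(1-\lambda)^3}\Bigr\}\Bigr\}\frac\Delta{\epsilon^2}.$$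 (ii) Let $C=\max\{m^{1/2}n^{-1/2}(1-\lambda)^{3/2},1\}$. If $B\ge\lceil C\rceil$, then the communication complexity is at most $$K\,\frac1{(1-\lambda)^2}\,\frac\Delta{\epsilon^2},$$ and this is the best possible bound: $(1-\lambda)^{-2}$ equals $k_B$ and is at most $k_{B'}$ for every $B'\in\{1,\dots,m\}$. If $B=\lceil C\rceil$, then the gradient complexity is at most $$K\max\Bigl\{\tfrac n{(1-\lambda)^2},\,\tfrac{N^{1/2}}{(1-\lambda)^{1/2}},\,\tfrac{m^{1/3}n^{2/3}}{1-\lambda}\Bigr\}\frac\Delta{\epsilon^2}.$$ -/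

import Mathlib

open MeasureTheory ProbabilityTheory
open scoped ENNReal

noncomputable section

namespace GTSarah

/-- The Euclidean space `ℝᵖ`. -/
abbrev E (p : ℕ) : Type := EuclideanSpace ℝ (Fin p)

/-! ### The finite-sum problem -/

/-- The local cost `f_i = (1/m) ∑_j f_{i,j}`. -/
def localCost {n m p : ℕ} (f : Fin n → Fin m → E p → ℝ) (i : Fin n) (x : E p) : ℝ :=
  (1 / (m : ℝ)) * ∑ j, f i j x

/-- The global cost `F = (1/n) ∑_i f_i`. -/
def globalCost {n m p : ℕ} (f : Fin n → Fin m → E p → ℝ) (x : E p) : ℝ :=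
  (1 / (n : ℝ)) * ∑ i, localCost f i x

/-- Differentiable component costs, mean-squared smoothness with parameter `L > 0` at every node,
and a global cost that is bounded below. -/
structure SmoothCosts {n m p : ℕ} (f : Fin n → Fin m → E p → ℝ) (L : ℝ) : Prop where
  pos : 0 < L
  differentiable : ∀ i j, Differentiable ℝ (f i j)
  mean_sq_smooth : ∀ i x y,
    (1 / (m : ℝ)) * ∑ j, ‖gradient (f i j) x - gradient (f i j) y‖ ^ 2 ≤ L ^ 2 * ‖x - y‖ ^ 2
  bddBelow : BddBelow (Set.range (globalCost f))

/-- `Δ = L (F(x₀) - F*) + (1/n) ∑_i ‖∇f_i(x₀)‖²`, where `F* = inf F`. -/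
def initialGap {n m p : ℕ} (f : Fin n → Fin m → E p → ℝ) (L : ℝ) (x₀ : E p) : ℝ :=
  L * (globalCost f x₀ - ⨅ x, globalCost f x)
    + (1 / (n : ℝ)) * ∑ i, ‖gradient (localCost f i) x₀‖ ^ 2

/-! ### The network -/

/-- `W` is a nonnegative, primitive, doubly stochastic weight matrix with positive diagonal that
respects the directed graph `G`; `G.Adj i r` means that node `r` sends information to node `i`,
and every node has a self-loop. -/
structure IsWeightMatrix {n : ℕ} (G : Digraph (Fin n)) (W : Matrix (Fin n) (Fin n) ℝ) : Prop where
  self_loop : ∀ i, G.Adj i i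
  respects : ∀ i r, ¬ G.Adj i r → W i r = 0
  diag_pos : ∀ i, 0 < W i i
  primitive : W.IsPrimitive
  doublyStochastic : W ∈ doublyStochastic ℝ (Fin n)

/-- `λ = ‖W - (1/n) 1 1ᵀ‖` in the spectral norm. -/
def mixing {n : ℕ} (W : Matrix (Fin n) (Fin n) ℝ) : ℝ :=
  ‖Matrix.toEuclideanCLM (n := Fin n) (𝕜 := ℝ) (W - Matrix.of fun _ _ => 1 / (n : ℝ))‖

/-! ### The algorithm -/

/-- The variables of all nodes between two iterations: the current states `x`, the previous states
`xPrev`, the gradient trackers `y`, the latest gradient estimators `v`; and two counters, for the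
component gradients computed so far across all nodes and for the rounds of communication so far. -/
structure State (n p : ℕ) where
  x : Fin n → E p
  xPrev : Fin n → E p
  y : Fin n → E p
  v : Fin n → E p
  gradEvals : ℕ
  commRounds : ℕ

/-- One round of communication, given the new gradient estimators `vNew` (and the number
`evals` of component gradients that were computed for them): gradient tracking
`y_i ← ∑_r w_{ir} y_r + vNew_i - v_i`, then state update `x_i ← ∑_r w_{ir} x_r - α y_i`
with the new `y_i`. -/
def mix {n p : ℕ} (W : Matrix (Fin n) (Fin n) ℝ) (α : ℝ) (σ : State n p)
    (vNew : Fin n → E p) (evals : ℕ) : State n p :=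
  let yNew : Fin n → E p := fun i => ∑ r, W i r • σ.y r + vNew i - σ.v i
  { x := fun i => ∑ r, W i r • σ.x r - α • yNew i
    xPrev := σ.x
    y := yNew
    v := vNew
    gradEvals := σ.gradEvals + evals
    commRounds := σ.commRounds + 1 }

/-- The iteration `t = 0` of an outer loop: every node computes its full local gradient. -/
def batchStep {n m p : ℕ} (f : Fin n → Fin m → E p → ℝ) (W : Matrix (Fin n) (Fin n) ℝ) (α : ℝ)
    (σ : State n p) : State n p :=
  mix W α σ (fun i => (1 / (m : ℝ)) • ∑ j, gradient (f i j) (σ.x i)) (n * m)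

/-- An iteration `t ≥ 1` of an outer loop, with the sampled indices `τ i l`: every node updates its
estimator recursively, with `2 B` component gradients. -/
def sarahStep {n m p B : ℕ} (f : Fin n → Fin m → E p → ℝ) (W : Matrix (Fin n) (Fin n) ℝ) (α : ℝ)
    (τ : Fin n → Fin B → Fin m) (σ : State n p) : State n p :=
  mix W α σ
    (fun i => (1 / (B : ℝ)) • ∑ l, (gradient (f i (τ i l)) (σ.x i)
      - gradient (f i (τ i l)) (σ.xPrev i)) + σ.v i)
    (n * (2 * B))

/-- The state before iteration `t` of an outer loop that starts from `σ`, where `τ t` are the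
indices sampled at iteration `t ≥ 1`. -/
def inner {n m p B : ℕ} (f : Fin n → Fin m → E p → ℝ) (W : Matrix (Fin n) (Fin n) ℝ) (α : ℝ)
    (τ : ℕ → Fin n → Fin B → Fin m) (σ : State n p) : ℕ → State n p
  | 0 => σ
  | 1 => batchStep f W α σ
  | t + 2 => sarahStep f W α (τ (t + 1)) (inner f W α τ σ (t + 1))

/-- The common start: `x_i = x₀`, `y_i = 0`, `v_i = 0` (`xPrev` is never read before it is set). -/
def initState {n p : ℕ} (x₀ : E p) : State n p where
  x := fun _ => x₀
  xPrev := fun _ => x₀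
  y := fun _ => 0
  v := fun _ => 0
  gradEvals := 0
  commRounds := 0

/-- The state after `s` outer loops, each of which performs the iterations `t = 0, 1, …, q`;
`τ s t` are the indices sampled at iteration `t` of outer loop `s` (with `s ≥ 1`). -/
def outer {n m p B : ℕ} (f : Fin n → Fin m → E p → ℝ) (W : Matrix (Fin n) (Fin n) ℝ) (α : ℝ)
    (q : ℕ) (x₀ : E p) (τ : ℕ → ℕ → Fin n → Fin B → Fin m) : ℕ → State n p
  | 0 => initState x₀
  | s + 1 => inner f W α (τ (s + 1)) (outer f W α q x₀ τ s) (q + 1)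

/-- The iterate `x_i^{t,s}`, for `s ≥ 1` and `0 ≤ t ≤ q`. -/
def iterate {n m p B : ℕ} (f : Fin n → Fin m → E p → ℝ) (W : Matrix (Fin n) (Fin n) ℝ) (α : ℝ)
    (q : ℕ) (x₀ : E p) (τ : ℕ → ℕ → Fin n → Fin B → Fin m) (t s : ℕ) (i : Fin n) : E p :=
  (inner f W α (τ s) (outer f W α q x₀ τ (s - 1)) t).x i

/-- The average `(1/n) ∑_i x_i^{t,s}`. -/
def meanIterate {n m p B : ℕ} (f : Fin n → Fin m → E p → ℝ) (W : Matrix (Fin n) (Fin n) ℝ) (α : ℝ)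
    (q : ℕ) (x₀ : E p) (τ : ℕ → ℕ → Fin n → Fin B → Fin m) (t s : ℕ) : E p :=
  (1 / (n : ℝ)) • ∑ i, iterate f W α q x₀ τ t s i

/-- The sampled indices `τ_{i,l}^{t,s}`, `s ≥ 1`, `1 ≤ t ≤ q`, are independent random variables
that are uniformly distributed on the `m` indices of a node. -/
structure IsUniformSampling {n m B : ℕ} {Ω : Type*} [MeasurableSpace Ω] (μ : Measure Ω) (q : ℕ)
    (τ : ℕ → ℕ → Fin n → Fin B → Ω → Fin m) : Prop where
  measurable : ∀ s t i l, 1 ≤ s → 1 ≤ t → t ≤ q → Measurable (τ s t i l)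
  uniform : ∀ s t i l, 1 ≤ s → 1 ≤ t → t ≤ q → ∀ j, μ (τ s t i l ⁻¹' {j}) = (m : ℝ≥0∞)⁻¹
  indep : iIndepFun
    (fun k : {k : ℕ × ℕ × Fin n × Fin B // 1 ≤ k.1 ∧ 1 ≤ k.2.1 ∧ k.2.1 ≤ q} =>
      τ k.1.1 k.1.2.1 k.1.2.2.1 k.1.2.2.2) μ

/-! ### Accuracy and complexity -/

/-- `‖∇F(x_i^{t,s})‖² + L² ‖x_i^{t,s} - x̄^{t,s}‖²` on the sample path `ω`. -/
def gap {n m p B : ℕ} (f : Fin n → Fin m → E p → ℝ) (W : Matrix (Fin n) (Fin n) ℝ) (L α : ℝ)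
    (q : ℕ) (x₀ : E p) {Ω : Type*} (τ : ℕ → ℕ → Fin n → Fin B → Ω → Fin m) (t s : ℕ) (i : Fin n)
    (ω : Ω) : ℝ :=
  let path : ℕ → ℕ → Fin n → Fin B → Fin m := fun s t i l => τ s t i l ω
  ‖gradient (globalCost f) (iterate f W α q x₀ path t s i)‖ ^ 2
    + L ^ 2 * ‖iterate f W α q x₀ path t s i - meanIterate f W α q x₀ path t s‖ ^ 2

/-- The algorithm finds an `ε`-accurate first-order stationary point of `F` in `S` outer loops:
the average over `1 ≤ s ≤ S`, `0 ≤ t ≤ q` and all nodes of the expected gap is at most `ε²`. -/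
def FindsIn {n m p B : ℕ} (f : Fin n → Fin m → E p → ℝ) (W : Matrix (Fin n) (Fin n) ℝ) (L α : ℝ)
    (q : ℕ) (x₀ : E p) {Ω : Type*} [MeasurableSpace Ω] (μ : Measure Ω)
    (τ : ℕ → ℕ → Fin n → Fin B → Ω → Fin m) (ε : ℝ) (S : ℕ) : Prop :=
  (∀ s ∈ Finset.Icc 1 S, ∀ t ∈ Finset.range (q + 1), ∀ i,
    Integrable (gap f W L α q x₀ τ t s i) μ) ∧
  1 / ((S : ℝ) * ((q : ℝ) + 1)) * ∑ s ∈ Finset.Icc 1 S, ∑ t ∈ Finset.range (q + 1),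
    (1 / (n : ℝ)) * ∑ i, ∫ ω, gap f W L α q x₀ τ t s i ω ∂μ ≤ ε ^ 2

/-- The number of component gradients computed across all nodes in `S` outer loops. -/
def gradCost (n m q B S : ℕ) : ℕ := S * (n * (m + 2 * q * B))

/-- The number of rounds of communication in `S` outer loops. -/
def commCost (q S : ℕ) : ℕ := S * (q + 1)

/-- `gradCost` and `commCost` are the counters of the algorithm, on every sample path. -/
theorem outer_counters {n m p B : ℕ} (f : Fin n → Fin m → E p → ℝ)
    (W : Matrix (Fin n) (Fin n) ℝ) (α : ℝ) (q : ℕ) (x₀ : E p)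
    (τ : ℕ → ℕ → Fin n → Fin B → Fin m) (S : ℕ) :
    (outer f W α q x₀ τ S).gradEvals = gradCost n m q B S ∧
      (outer f W α q x₀ τ S).commRounds = commCost q S := by
  have key : ∀ (ρ : ℕ → Fin n → Fin B → Fin m) (σ : State n p) (t : ℕ),
      (inner f W α ρ σ (t + 1)).gradEvals = σ.gradEvals + n * (m + 2 * t * B) ∧
        (inner f W α ρ σ (t + 1)).commRounds = σ.commRounds + (t + 1) := by
    intro ρ σ t
    induction t with
    | zero => simp [inner, batchStep, mix]
    | succ t ih =>
      simp only [inner, sarahStep, mix, ih.1, ih.2]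
      constructor <;> ring
  induction S with
  | zero => simp [outer, initState, gradCost, commCost]
  | succ S ih =>
    simp only [outer, (key _ _ q).1, (key _ _ q).2, ih.1, ih.2, gradCost, commCost]
    constructor <;> ring

/-- The complexity, in the resource that `cost S` measures after `S` outer loops, of reaching
`finds` is at most `T`: `finds S` holds for every number `S ≥ 1` of outer loops that uses at least
`T` of the resource, and it holds for some `S ≥ 1` that uses at most `T` of the resource, or at
most one outer loop, the least that can be run. -/
def ComplexityAtMost (finds : ℕ → Prop) (cost : ℕ → ℕ) (T : ℝ) : Prop :=
  (∀ S, 1 ≤ S → T ≤ cost S → finds S) ∧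
    ∃ S, 1 ≤ S ∧ finds S ∧ (cost S : ℝ) ≤ max T (cost 1)

/-! ### The parameters and the bounds (with `g` for the spectral gap `1 - λ`) -/

/-- `min {(1-λ)², n^{1/2} B / m^{1/2}, n^{1/3} B^{2/3} (1-λ) / m^{1/3}} / L`, the order of the
step-size. -/
def stepScale (n m B : ℕ) (g L : ℝ) : ℝ :=
  min (g ^ 2) (min ((n : ℝ) ^ (1 / 2 : ℝ) * B / (m : ℝ) ^ (1 / 2 : ℝ))
    ((n : ℝ) ^ (1 / 3 : ℝ) * (B : ℝ) ^ (2 / 3 : ℝ) * g / (m : ℝ) ^ (1 / 3 : ℝ))) * (1 / L)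

/-- The factor of `Δ/ε²` in the gradient complexity for the minibatch size `B`. -/
def gradBound (n m B : ℕ) (g : ℝ) : ℝ :=
  max (n * B / g ^ 2) (max (((n * m : ℕ) : ℝ) ^ (1 / 2 : ℝ))
    ((m : ℝ) ^ (1 / 3 : ℝ) * (n : ℝ) ^ (2 / 3 : ℝ) * (B : ℝ) ^ (1 / 3 : ℝ) / g))

/-- The factor of `Δ/ε²` in the communication complexity for the minibatch size `B`. -/
def commBound (n m B : ℕ) (g : ℝ) : ℝ :=
  max (1 / g ^ 2) (max ((m : ℝ) ^ (1 / 2 : ℝ) / ((n : ℝ) ^ (1 / 2 : ℝ) * B))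
    ((m : ℝ) ^ (1 / 3 : ℝ) / ((n : ℝ) ^ (1 / 3 : ℝ) * (B : ℝ) ^ (2 / 3 : ℝ) * g)))

/-- `R = max {m^{1/2} n^{-1/2} (1-λ)³, 1}`. -/
def thresholdR (n m : ℕ) (g : ℝ) : ℝ :=
  max ((m : ℝ) ^ (1 / 2 : ℝ) * (n : ℝ) ^ (-(1 / 2) : ℝ) * g ^ 3) 1

/-- `C = max {m^{1/2} n^{-1/2} (1-λ)^{3/2}, 1}`. -/
def thresholdC (n m : ℕ) (g : ℝ) : ℝ :=
  max ((m : ℝ) ^ (1 / 2 : ℝ) * (n : ℝ) ^ (-(1 / 2) : ℝ) * g ^ (3 / 2 : ℝ)) 1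

/-- `max {n/(1-λ)², N^{1/2}, m^{1/3} n^{2/3}/(1-λ)}`. -/
def boundHR (n m : ℕ) (g : ℝ) : ℝ :=
  max (n / g ^ 2) (max (((n * m : ℕ) : ℝ) ^ (1 / 2 : ℝ))
    ((m : ℝ) ^ (1 / 3 : ℝ) * (n : ℝ) ^ (2 / 3 : ℝ) / g))

/-- `max {1/(1-λ)², min {m^{1/2}/n^{1/2}, 1/(1-λ)³}, min {m^{1/3}/(n^{1/3}(1-λ)), 1/(1-λ)³}}`. -/
def boundKR (n m : ℕ) (g : ℝ) : ℝ :=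
  max (1 / g ^ 2)
    (max (min ((m : ℝ) ^ (1 / 2 : ℝ) / (n : ℝ) ^ (1 / 2 : ℝ)) (1 / g ^ 3))
      (min ((m : ℝ) ^ (1 / 3 : ℝ) / ((n : ℝ) ^ (1 / 3 : ℝ) * g)) (1 / g ^ 3)))

/-- `1/(1-λ)²`. -/
def boundKC (g : ℝ) : ℝ := 1 / g ^ 2

/-- `max {n/(1-λ)², N^{1/2}/(1-λ)^{1/2}, m^{1/3} n^{2/3}/(1-λ)}`. -/
def boundHC (n m : ℕ) (g : ℝ) : ℝ :=
  max (n / g ^ 2) (max (((n * m : ℕ) : ℝ) ^ (1 / 2 : ℝ) / g ^ (1 / 2 : ℝ))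
    ((m : ℝ) ^ (1 / 3 : ℝ) * (n : ℝ) ^ (2 / 3 : ℝ) / g))

end GTSarah

end

open GTSarah

/-! The bounds come from a Lyapunov function (`potential`): the cost at the mean state, plus
weighted consensus errors of states and trackers, the last squared move, and the squared errors of
the gradient estimators. In conditional expectation it loses at least `α / 4 * avgGap` per
iteration.

Double stochasticity keeps the mean tracker equal to the mean estimator (`mean_mix_y`), so the mean
state performs an inexact gradient step, while each round of mixing contracts consensus errors by
`mixing W < 1` (`mixing_lt_one`). The recursive estimator error is a martingale within an outer
loop: the mean error gains variance at most `L² / (n² B)` times the squared move, since the nodes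
sample independently. Descent charges `α` times the new squared mean error in every iteration; the
weight `α (q + 1 - t)` drops by `α` per step to pay for this and vanishes at the end of the loop. At
the full-gradient step the trackers feel the jump of the estimators, for which the term `cE * ∑
‖gradError‖²` is held in reserve.

The state is a function of finitely many past samples with finitely many values. Hence everything is
integrable, and the conditional expectation is a finite average over the new samples
(`integral_stateAt_succ`). Telescoping over all loops (`sum_integral_avgGap_le`) with the
coefficients of `exists_isAdmissible` shows that `8 Δ / (α L ε²)` iterations suffice
(`findsIn_of_le`). The three terms of `stepScale` are what the three smallness conditions on `α L`
require.

Since `stepScale * L` is the inverse of `commBound`, this is of order `commBound * Δ / ε²`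
iterations. One iteration costs one round of communication and, as `q` is at least of order `m / B`,
on average of order `n B` gradients, which turns `commBound` into `gradBound`. What remains is to
compare monomials at the two threshold batch sizes, where rounding costs a factor of at most 2. -/

namespace GTSarah

open scoped RealInnerProductSpace

/-! ### Averages over the nodes -/

section Averages

variable {n : ℕ} {V : Type*} [NormedAddCommGroup V] [InnerProductSpace ℝ V]

/-- The average of a family of vectors over the nodes. -/
noncomputable def mean (z : Fin n → V) : V := (1 / (n : ℝ)) • ∑ i, z i

/-- The squared distance of a family of vectors to consensus. -/
noncomputable def spread (z : Fin n → V) : ℝ := ∑ i, ‖z i - mean z‖ ^ 2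

lemma mean_add (z w : Fin n → V) : mean (fun i => z i + w i) = mean z + mean w := by
  simp [mean, Finset.sum_add_distrib]

lemma mean_sub (z w : Fin n → V) : mean (fun i => z i - w i) = mean z - mean w := by
  simp [mean, Finset.sum_sub_distrib, smul_sub]

lemma mean_smul (c : ℝ) (z : Fin n → V) : mean (fun i => c • z i) = c • mean z := by
  simp [mean, ← Finset.smul_sum, smul_comm c]

lemma nsmul_mean (hn : 1 ≤ n) (z : Fin n → V) : (n : ℝ) • mean z = ∑ i, z i := by
  have : (n : ℝ) ≠ 0 := by positivity
  rw [mean, smul_smul, mul_one_div_cancel this, one_smul]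

lemma mean_const (hn : 1 ≤ n) (c : V) : mean (fun _ : Fin n => c) = c := by
  have : (n : ℝ) ≠ 0 := by positivity
  simp [mean, ← Nat.cast_smul_eq_nsmul ℝ, smul_smul, this]

lemma spread_nonneg (z : Fin n → V) : 0 ≤ spread z := Finset.sum_nonneg fun _ _ => by positivity

lemma spread_eq (hn : 1 ≤ n) (z : Fin n → V) :
    spread z = ∑ i, ‖z i‖ ^ 2 - n * ‖mean z‖ ^ 2 := by
  have h : ∑ i, ⟪z i, mean z⟫ = n * ‖mean z‖ ^ 2 := by
    rw [← sum_inner, ← nsmul_mean hn, real_inner_smul_left, real_inner_self_eq_norm_sq]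
  simp only [spread, norm_sub_sq_real, Finset.sum_add_distrib, Finset.sum_sub_distrib,
    ← Finset.mul_sum, h]
  simp
  ring

lemma spread_le_sum (hn : 1 ≤ n) (z : Fin n → V) : spread z ≤ ∑ i, ‖z i‖ ^ 2 := by
  rw [spread_eq hn]
  have : 0 ≤ n * ‖mean z‖ ^ 2 := by positivity
  linarith

lemma norm_mean_sq_le (hn : 1 ≤ n) (z : Fin n → V) :
    n * ‖mean z‖ ^ 2 ≤ ∑ i, ‖z i‖ ^ 2 := by
  have := spread_nonneg z
  rw [spread_eq hn] at this
  linarith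

lemma norm_avg_sq_le (hn : 1 ≤ n) (z : Fin n → V) :
    ‖(1 / (n : ℝ)) • ∑ i, z i‖ ^ 2 ≤ 1 / (n : ℝ) * ∑ i, ‖z i‖ ^ 2 := by
  have h := norm_mean_sq_le hn z
  have hn' : (0 : ℝ) < n := by positivity
  rw [one_div_mul_eq_div, le_div_iff₀ hn', mul_comm]
  exact h

end Averages

/-! ### Young's inequality and perturbed contractions -/

section Young

variable {n : ℕ} {V : Type*} [NormedAddCommGroup V]

lemma norm_add_sq_le_young (a b : V) {η : ℝ} (hη : 0 < η) :
    ‖a + b‖ ^ 2 ≤ (1 + η) * ‖a‖ ^ 2 + (1 + 1 / η) * ‖b‖ ^ 2 := by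
  have h1 : ‖a + b‖ ^ 2 ≤ (‖a‖ + ‖b‖) ^ 2 := by
    gcongr
    exact norm_add_le a b
  have h2 : 2 * ‖a‖ * ‖b‖ ≤ η * ‖a‖ ^ 2 + 1 / η * ‖b‖ ^ 2 := by
    have : 0 ≤ (1 / η) * (η * ‖a‖ - ‖b‖) ^ 2 := by positivity
    have e : (1 / η) * (η * ‖a‖ - ‖b‖) ^ 2
        = η * ‖a‖ ^ 2 + 1 / η * ‖b‖ ^ 2 - 2 * ‖a‖ * ‖b‖ := by
      field_simp
      ring
    linarith
  nlinarith

lemma norm_add_sq_le_two (a b : V) : ‖a + b‖ ^ 2 ≤ 2 * ‖a‖ ^ 2 + 2 * ‖b‖ ^ 2 := by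
  have := norm_add_sq_le_young a b one_pos
  norm_num at this
  linarith

lemma norm_add_three_sq_le (a b c : V) :
    ‖a + b + c‖ ^ 2 ≤ 3 * ‖a‖ ^ 2 + 3 * ‖b‖ ^ 2 + 3 * ‖c‖ ^ 2 := by
  have h1 := norm_add_sq_le_young (a + b) c (η := 1 / 2) (by norm_num)
  have h2 := norm_add_sq_le_two a b
  norm_num at h1
  linarith

/-- A contraction by `lam`, perturbed by `b`. -/
lemma sum_norm_add_sq_le (a b : Fin n → V) {lam X : ℝ} (h0 : 0 ≤ lam) (h1 : lam < 1)
    (ha : ∑ i, ‖a i‖ ^ 2 ≤ lam ^ 2 * X) :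
    ∑ i, ‖a i + b i‖ ^ 2 ≤ lam * X + 1 / (1 - lam) * ∑ i, ‖b i‖ ^ 2 := by
  rcases h0.eq_or_lt with rfl | h0
  · have hz : ∀ i, a i = 0 := by
      have : ∑ i, ‖a i‖ ^ 2 = 0 :=
        le_antisymm (by simpa using ha) (Finset.sum_nonneg fun _ _ => by positivity)
      rw [Finset.sum_eq_zero_iff_of_nonneg fun _ _ => by positivity] at this
      intro i
      simpa using this i (Finset.mem_univ i)
    simp [hz]
  -- This `η` makes `1 + η = 1 / lam`, so one of the two factors `lam` in the contraction survives;
  -- `lam = 0` is excluded because `η` would be infinite.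
  · have hη : 0 < (1 - lam) / lam := div_pos (by linarith) h0
    have e1 : 1 + (1 - lam) / lam = 1 / lam := by field_simp; ring
    have e2 : 1 + 1 / ((1 - lam) / lam) = 1 / (1 - lam) := by
      have : 1 - lam ≠ 0 := by linarith
      field_simp
      ring
    calc ∑ i, ‖a i + b i‖ ^ 2
        ≤ ∑ i, (1 / lam * ‖a i‖ ^ 2 + 1 / (1 - lam) * ‖b i‖ ^ 2) :=
          Finset.sum_le_sum fun i _ => by
            have := norm_add_sq_le_young (a i) (b i) hη
            rwa [e1, e2] at this
      _ = 1 / lam * ∑ i, ‖a i‖ ^ 2 + 1 / (1 - lam) * ∑ i, ‖b i‖ ^ 2 := by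
          rw [Finset.sum_add_distrib, Finset.mul_sum, Finset.mul_sum]
      _ ≤ 1 / lam * (lam ^ 2 * X) + 1 / (1 - lam) * ∑ i, ‖b i‖ ^ 2 := by gcongr
      _ = _ := by
          congr 1
          field_simp

end Young

/-! ### The weight matrix -/

section Network

variable {n : ℕ}

lemma mixing_nonneg (W : Matrix (Fin n) (Fin n) ℝ) : 0 ≤ mixing W := norm_nonneg _

/-- The average of the variances in the rows of a doubly stochastic matrix. -/
lemma sum_variance_doublyStochastic {P : Matrix (Fin n) (Fin n) ℝ}
    (hP : P ∈ doublyStochastic ℝ (Fin n)) (u : Fin n → ℝ) :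
    ∑ i, ∑ r, P i r * (u r - (P.mulVec u) i) ^ 2
      = ∑ i, u i ^ 2 - ∑ i, (P.mulVec u) i ^ 2 := by
  have h1 : ∀ i, ∑ r, P i r * (u r - (P.mulVec u) i) ^ 2
      = ∑ r, P i r * u r ^ 2 - (P.mulVec u) i ^ 2 := by
    intro i
    have e : ∀ r, P i r * (u r - (P.mulVec u) i) ^ 2
        = P i r * u r ^ 2 - 2 * (P.mulVec u) i * (P i r * u r) + (P.mulVec u) i ^ 2 * P i r :=
      fun r => by ring
    simp only [e, Finset.sum_add_distrib, Finset.sum_sub_distrib, ← Finset.mul_sum,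
      sum_row_of_mem_doublyStochastic hP i]
    have : ∑ r, P i r * u r = (P.mulVec u) i := rfl
    rw [this]
    ring
  simp only [h1, Finset.sum_sub_distrib]
  congr 1
  rw [Finset.sum_comm]
  refine Finset.sum_congr rfl fun r _ => ?_
  rw [← Finset.sum_mul, sum_col_of_mem_doublyStochastic hP r, one_mul]

lemma sum_sq_mulVec_le {P : Matrix (Fin n) (Fin n) ℝ}
    (hP : P ∈ doublyStochastic ℝ (Fin n)) (u : Fin n → ℝ) :
    ∑ i, (P.mulVec u) i ^ 2 ≤ ∑ i, u i ^ 2 := by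
  have h := sum_variance_doublyStochastic hP u
  have : 0 ≤ ∑ i, ∑ r, P i r * (u r - (P.mulVec u) i) ^ 2 :=
    Finset.sum_nonneg fun i _ => Finset.sum_nonneg fun r _ =>
      mul_nonneg (nonneg_of_mem_doublyStochastic hP) (sq_nonneg _)
  linarith

/-- The equality case of Jensen's inequality: if no norm is lost, the variance in every row
vanishes, so `u` is constant on the support of each row. -/
lemma eq_mulVec_of_sum_sq_eq {P : Matrix (Fin n) (Fin n) ℝ}
    (hP : P ∈ doublyStochastic ℝ (Fin n)) {u : Fin n → ℝ}
    (h : ∑ i, u i ^ 2 ≤ ∑ i, (P.mulVec u) i ^ 2) {i r : Fin n} (hir : 0 < P i r) :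
    u r = (P.mulVec u) i := by
  have hnn : ∀ i r, 0 ≤ P i r * (u r - (P.mulVec u) i) ^ 2 := fun i r =>
    mul_nonneg (nonneg_of_mem_doublyStochastic hP) (sq_nonneg _)
  have h0 : ∑ i, ∑ r, P i r * (u r - (P.mulVec u) i) ^ 2 = 0 :=
    le_antisymm (by rw [sum_variance_doublyStochastic hP]; linarith)
      (Finset.sum_nonneg fun i _ => Finset.sum_nonneg fun r _ => hnn i r)
  rw [Finset.sum_eq_zero_iff_of_nonneg fun i _ => Finset.sum_nonneg fun r _ => hnn i r] at h0
  have h1 := h0 i (Finset.mem_univ i)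
  rw [Finset.sum_eq_zero_iff_of_nonneg fun r _ => hnn i r] at h1
  have h2 := h1 r (Finset.mem_univ r)
  have h3 : (u r - (P.mulVec u) i) ^ 2 = 0 := by
    rcases mul_eq_zero.mp h2 with h | h
    · exact absurd h hir.ne'
    · exact h
  have := pow_eq_zero_iff (two_ne_zero) |>.mp h3
  linarith

/-- The matrix `W - (1/n) 1 1ᵀ` acts as `W` after centering. -/
lemma sub_avg_mulVec {W : Matrix (Fin n) (Fin n) ℝ}
    (hW : W ∈ doublyStochastic ℝ (Fin n)) (u : Fin n → ℝ) :
    (W - Matrix.of fun _ _ => 1 / (n : ℝ)).mulVec u = W.mulVec (fun i => u i - mean u) := by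
  funext i
  simp only [Matrix.mulVec, dotProduct, Matrix.sub_apply, Matrix.of_apply, sub_mul, mul_sub,
    Finset.sum_sub_distrib, ← Finset.mul_sum, ← Finset.sum_mul,
    sum_row_of_mem_doublyStochastic hW i, mean, smul_eq_mul, one_mul]

/-- If no norm were lost, `u` would have mean zero, because centering must lose nothing either. The
positive diagonal would then give `W u = u`, and a power of `W` with positive entries would force
`u` to be constant, hence zero. -/
lemma norm_sub_avg_lt (hn : 1 ≤ n) {G : Digraph (Fin n)} {W : Matrix (Fin n) (Fin n) ℝ}
    (hW : IsWeightMatrix G W) {u : Fin n → ℝ} (hu : u ≠ 0) :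
    ∑ i, ((W - Matrix.of fun _ _ => 1 / (n : ℝ)).mulVec u) i ^ 2 < ∑ i, u i ^ 2 := by
  by_contra! hle
  have hds := hW.doublyStochastic
  rw [sub_avg_mulVec hds] at hle
  set w : Fin n → ℝ := fun i => u i - mean u with hw
  have hspread : ∑ i, w i ^ 2 = ∑ i, u i ^ 2 - n * (mean u) ^ 2 := by
    have := spread_eq hn u
    simpa [spread, Real.norm_eq_abs, sq_abs] using this
  have h1 := sum_sq_mulVec_le hds w
  have hn' : (0 : ℝ) < n := by positivity
  have hm : mean u = 0 := by
    have : n * (mean u) ^ 2 ≤ 0 := by linarith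
    by_contra hne
    have : 0 < n * (mean u) ^ 2 := by positivity
    linarith
  have hwu : w = u := by
    funext i
    simp [hw, hm]
  rw [hwu] at hle
  have hfix : W.mulVec u = u := by
    funext i
    exact (eq_mulVec_of_sum_sq_eq hds hle (hW.diag_pos i)).symm
  obtain ⟨k, -, hk⟩ := hW.primitive.exists_pos_pow
  have hfixk : ∀ k, (W ^ k).mulVec u = u := by
    intro k
    induction k with
    | zero => simp
    | succ k ih => rw [pow_succ, ← Matrix.mulVec_mulVec, hfix, ih]
  have hdsk : W ^ k ∈ doublyStochastic ℝ (Fin n) := pow_mem hds k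
  have hconst : ∀ i r, u r = u i := by
    intro i r
    have := eq_mulVec_of_sum_sq_eq hdsk (u := u) (by rw [hfixk]) (hk i r)
    rwa [hfixk] at this
  apply hu
  funext i
  have : mean u = u i := by
    have hc : u = fun _ => u i := funext fun r => hconst i r
    rw [hc, mean_const hn]
  rw [← this, hm]
  rfl

lemma mixing_lt_one (hn : 1 ≤ n) {G : Digraph (Fin n)} {W : Matrix (Fin n) (Fin n) ℝ}
    (hW : IsWeightMatrix G W) : mixing W < 1 := by
  set M := Matrix.toEuclideanCLM (n := Fin n) (𝕜 := ℝ) (W - Matrix.of fun _ _ => 1 / (n : ℝ))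
    with hM
  have hlt : ∀ u, u ≠ 0 → ‖M u‖ < ‖u‖ := by
    intro u hu
    rw [← sq_lt_sq₀ (norm_nonneg _) (norm_nonneg _), EuclideanSpace.real_norm_sq_eq,
      EuclideanSpace.real_norm_sq_eq]
    have hu' : u.ofLp ≠ 0 := fun h => hu (by ext i; simp [h])
    exact norm_sub_avg_lt hn hW hu'
  -- The operator norm is attained on the compact unit ball, so the strict pointwise inequality
  -- passes to the norm.
  obtain ⟨u₀, hu₀, hmax⟩ := (isCompact_closedBall (0 : EuclideanSpace ℝ (Fin n)) 1).exists_isMaxOn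
    ⟨0, by simp⟩ (f := fun u => ‖M u‖) (by fun_prop)
  have hle : ‖M‖ ≤ ‖M u₀‖ := by
    refine M.opNorm_le_of_unit_norm (norm_nonneg _) fun u hu => ?_
    exact hmax (by simp [hu])
  refine hle.trans_lt ?_
  by_cases h : u₀ = 0
  · simp [h]
  · refine (hlt u₀ h).trans_le ?_
    simpa using hu₀

lemma sum_sq_mixing_le (hn : 1 ≤ n) {W : Matrix (Fin n) (Fin n) ℝ}
    (hW : W ∈ doublyStochastic ℝ (Fin n)) (u : Fin n → ℝ) :
    ∑ i, (∑ r, W i r * u r - mean u) ^ 2 ≤ mixing W ^ 2 * ∑ i, (u i - mean u) ^ 2 := by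
  set c : Fin n → ℝ := fun i => u i - mean u with hc
  have hmc : mean c = 0 := by
    rw [hc, mean_sub, mean_const hn, sub_self]
  have h := (Matrix.toEuclideanCLM (n := Fin n) (𝕜 := ℝ)
    (W - Matrix.of fun _ _ => 1 / (n : ℝ))).le_opNorm (WithLp.toLp 2 c)
  have h2 := pow_le_pow_left₀ (norm_nonneg _) h 2
  rw [mul_pow, EuclideanSpace.real_norm_sq_eq, EuclideanSpace.real_norm_sq_eq] at h2
  refine le_trans (le_of_eq ?_) h2
  refine Finset.sum_congr rfl fun i _ => ?_
  rw [Matrix.ofLp_toEuclideanCLM, sub_avg_mulVec hW]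
  simp only [hmc, sub_zero]
  simp only [hc, Matrix.mulVec, dotProduct, mul_sub, Finset.sum_sub_distrib, ← Finset.sum_mul,
    sum_row_of_mem_doublyStochastic hW i, one_mul]

/-- One round of communication contracts the distance to consensus by `mixing W`. -/
lemma sum_norm_mixing_le {p : ℕ} (hn : 1 ≤ n) {W : Matrix (Fin n) (Fin n) ℝ}
    (hW : W ∈ doublyStochastic ℝ (Fin n)) (z : Fin n → E p) :
    ∑ i, ‖∑ r, W i r • z r - mean z‖ ^ 2 ≤ mixing W ^ 2 * spread z := by
  have hm : ∀ c, (mean z) c = mean (fun i => z i c) := by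
    intro c
    simp [mean]
  -- The spectral norm bounds scalar families; vectors are treated one coordinate at a time.
  simp only [spread, EuclideanSpace.real_norm_sq_eq]
  rw [Finset.sum_comm]
  conv_rhs => rw [Finset.sum_comm, Finset.mul_sum]
  refine Finset.sum_le_sum fun c _ => ?_
  have := sum_sq_mixing_le hn hW (fun i => z i c)
  simpa [hm] using this

lemma mean_mixing {p : ℕ} {W : Matrix (Fin n) (Fin n) ℝ}
    (hW : W ∈ doublyStochastic ℝ (Fin n)) (z : Fin n → E p) :
    mean (fun i => ∑ r, W i r • z r) = mean z := by
  simp only [mean]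
  rw [Finset.sum_comm]
  simp only [← Finset.sum_smul, sum_col_of_mem_doublyStochastic hW, one_smul]

end Network

/-! ### Smoothness -/

section Smoothness

variable {n m p : ℕ}

lemma hasGradientAt_mean {g : Fin n → E p → ℝ} {x : E p}
    (h : ∀ i, DifferentiableAt ℝ (g i) x) :
    HasGradientAt (fun y => (1 / (n : ℝ)) * ∑ i, g i y) (mean fun i => gradient (g i) x) x := by
  have h1 : HasFDerivAt (fun y => (1 / (n : ℝ)) * ∑ i, g i y)
      ((1 / (n : ℝ)) • ∑ i, fderiv ℝ (g i) x) x :=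
    (HasFDerivAt.fun_sum fun i _ => (h i).hasFDerivAt).const_mul _
  rw [hasGradientAt_iff_hasFDerivAt]
  refine h1.congr_fderiv ?_
  simp [mean, gradient]

lemma gradient_localCost {f : Fin n → Fin m → E p → ℝ} (hd : ∀ i j, Differentiable ℝ (f i j))
    (i : Fin n) (x : E p) :
    gradient (localCost f i) x = mean (fun j => gradient (f i j) x) :=
  (hasGradientAt_mean fun j => (hd i j) x).gradient

lemma differentiable_localCost {f : Fin n → Fin m → E p → ℝ}
    (hd : ∀ i j, Differentiable ℝ (f i j)) (i : Fin n) : Differentiable ℝ (localCost f i) :=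
  fun x => (hasGradientAt_mean fun j => (hd i j) x).differentiableAt

lemma gradient_globalCost {f : Fin n → Fin m → E p → ℝ} (hd : ∀ i j, Differentiable ℝ (f i j))
    (x : E p) : gradient (globalCost f) x = mean (fun i => gradient (localCost f i) x) :=
  (hasGradientAt_mean fun i => differentiable_localCost hd i x).gradient

lemma differentiable_globalCost {f : Fin n → Fin m → E p → ℝ}
    (hd : ∀ i j, Differentiable ℝ (f i j)) : Differentiable ℝ (globalCost f) :=
  fun x => (hasGradientAt_mean fun i => differentiable_localCost hd i x).differentiableAt

variable {f : Fin n → Fin m → E p → ℝ} {L : ℝ}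

lemma SmoothCosts.norm_gradient_localCost_sub_sq_le (hf : SmoothCosts f L) (hm : 1 ≤ m)
    (i : Fin n) (x y : E p) :
    ‖gradient (localCost f i) x - gradient (localCost f i) y‖ ^ 2 ≤ L ^ 2 * ‖x - y‖ ^ 2 := by
  rw [gradient_localCost hf.differentiable, gradient_localCost hf.differentiable, ← mean_sub]
  exact (norm_avg_sq_le hm _).trans (hf.mean_sq_smooth i x y)

lemma SmoothCosts.norm_gradient_globalCost_sub_sq_le (hf : SmoothCosts f L) (hn : 1 ≤ n)
    (hm : 1 ≤ m) (x y : E p) :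
    ‖gradient (globalCost f) x - gradient (globalCost f) y‖ ^ 2 ≤ L ^ 2 * ‖x - y‖ ^ 2 := by
  rw [gradient_globalCost hf.differentiable, gradient_globalCost hf.differentiable, ← mean_sub]
  refine (norm_avg_sq_le hn _).trans ?_
  have hn' : (0 : ℝ) < n := by positivity
  rw [one_div_mul_eq_div, div_le_iff₀ hn']
  calc _ ≤ ∑ _i : Fin n, L ^ 2 * ‖x - y‖ ^ 2 :=
        Finset.sum_le_sum fun i _ => hf.norm_gradient_localCost_sub_sq_le hm i x y
    _ = _ := by simp; ring

/-- The descent inequality for a function with `L`-Lipschitz gradient. -/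
lemma descent_of_lipschitz_gradient {F : E p → ℝ} (hF : Differentiable ℝ F) (hL : 0 ≤ L)
    (hlip : ∀ x y, ‖gradient F x - gradient F y‖ ^ 2 ≤ L ^ 2 * ‖x - y‖ ^ 2) (x d : E p) :
    F (x + d) ≤ F x + ⟪gradient F x, d⟫ + L / 2 * ‖d‖ ^ 2 := by
  have hlip' : ∀ x y, ‖gradient F x - gradient F y‖ ≤ L * ‖x - y‖ := fun x y => by
    refine le_of_sq_le_sq ?_ (by positivity)
    rw [mul_pow]
    exact hlip x y
  -- The claim is `φ 1 ≤ φ 0`. The derivative of `φ` is nonpositive on `(0, 1)` by Cauchy–Schwarz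
  -- and the Lipschitz bound, with no continuity of the gradient needed.
  set φ : ℝ → ℝ := fun t => F (x + t • d) - t * ⟪gradient F x, d⟫ - L / 2 * t ^ 2 * ‖d‖ ^ 2 with hφ
  have hder : ∀ t, HasDerivAt φ
      (⟪gradient F (x + t • d), d⟫ - ⟪gradient F x, d⟫ - L * t * ‖d‖ ^ 2) t := by
    intro t
    have h1 : HasDerivAt (fun t : ℝ => x + t • d) d t := by
      simpa using ((hasDerivAt_id t).smul_const d).const_add x
    have h2 : HasDerivAt (fun t : ℝ => F (x + t • d)) ⟪gradient F (x + t • d), d⟫ t := by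
      have := (hF (x + t • d)).hasGradientAt.hasFDerivAt.comp_hasDerivAt t h1
      rw [InnerProductSpace.toDual_apply_apply] at this
      exact this
    have h3 : HasDerivAt (fun t : ℝ => t * ⟪gradient F x, d⟫) ⟪gradient F x, d⟫ t := by
      simpa using (hasDerivAt_id t).mul_const ⟪gradient F x, d⟫
    have h4 : HasDerivAt (fun t : ℝ => L / 2 * t ^ 2 * ‖d‖ ^ 2) (L * t * ‖d‖ ^ 2) t := by
      have := ((hasDerivAt_pow 2 t).const_mul (L / 2)).mul_const (‖d‖ ^ 2)
      refine this.congr_deriv ?_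
      push_cast
      ring
    exact (h2.sub h3).sub h4
  have hanti : AntitoneOn φ (Set.Icc 0 1) := by
    refine antitoneOn_of_deriv_nonpos (convex_Icc 0 1)
      (fun t _ => (hder t).continuousAt.continuousWithinAt)
      (fun t _ => (hder t).differentiableAt.differentiableWithinAt) fun t ht => ?_
    rw [interior_Icc] at ht
    rw [(hder t).deriv, ← inner_sub_left]
    have h1 := real_inner_le_norm (gradient F (x + t • d) - gradient F x) d
    have h2 := hlip' (x + t • d) x
    rw [add_sub_cancel_left, norm_smul, Real.norm_eq_abs, abs_of_pos ht.1] at h2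
    have h3 := mul_le_mul_of_nonneg_right h2 (norm_nonneg d)
    nlinarith
  have h := hanti (Set.left_mem_Icc.2 zero_le_one) (Set.right_mem_Icc.2 zero_le_one) zero_le_one
  simp only [hφ, zero_smul, add_zero, one_smul] at h
  linarith

/-- The descent of a gradient step with an inexact gradient. -/
lemma SmoothCosts.descent (hf : SmoothCosts f L) (hn : 1 ≤ n) (hm : 1 ≤ m) {α : ℝ} (x v : E p) :
    globalCost f (x - α • v) ≤ globalCost f x - α / 2 * ‖gradient (globalCost f) x‖ ^ 2
      - α / 2 * (1 - α * L) * ‖v‖ ^ 2 + α / 2 * ‖v - gradient (globalCost f) x‖ ^ 2 := by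
  have h := descent_of_lipschitz_gradient (differentiable_globalCost hf.differentiable) hf.pos.le
    (hf.norm_gradient_globalCost_sub_sq_le hn hm) x (-(α • v))
  rw [← sub_eq_add_neg] at h
  refine h.trans (le_of_eq ?_)
  rw [inner_neg_right, inner_smul_right, norm_neg, norm_smul, norm_sub_sq_real,
    real_inner_comm v, mul_pow, Real.norm_eq_abs, sq_abs]
  ring

end Smoothness

/-! ### One iteration -/

section Iteration

variable {n m p : ℕ}

/-- The errors of the gradient estimators, at the states for which they were computed. -/
noncomputable def gradError (f : Fin n → Fin m → E p → ℝ) (σ : State n p) (i : Fin n) : E p :=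
  σ.v i - gradient (localCost f i) (σ.xPrev i)

/-- The squared length of the last move. -/
noncomputable def moveSq (σ : State n p) : ℝ := ∑ i, ‖σ.x i - σ.xPrev i‖ ^ 2

/-- The average over the nodes of `‖∇F(x_i)‖² + L² ‖x_i - x̄‖²`. -/
noncomputable def avgGap (f : Fin n → Fin m → E p → ℝ) (L : ℝ) (σ : State n p) : ℝ :=
  (1 / (n : ℝ)) * ∑ i, (‖gradient (globalCost f) (σ.x i)‖ ^ 2 + L ^ 2 * ‖σ.x i - mean σ.x‖ ^ 2)

lemma moveSq_nonneg (σ : State n p) : 0 ≤ moveSq σ := Finset.sum_nonneg fun _ _ => by positivity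

variable {f : Fin n → Fin m → E p → ℝ} {L : ℝ}

lemma SmoothCosts.avgGap_le (hf : SmoothCosts f L) (hn : 1 ≤ n) (hm : 1 ≤ m) (σ : State n p) :
    avgGap f L σ ≤ 2 * ‖gradient (globalCost f) (mean σ.x)‖ ^ 2
      + 3 * (L ^ 2 / n) * spread σ.x := by
  have hn' : (0 : ℝ) < n := by positivity
  have h : ∀ i, ‖gradient (globalCost f) (σ.x i)‖ ^ 2 + L ^ 2 * ‖σ.x i - mean σ.x‖ ^ 2
      ≤ 2 * ‖gradient (globalCost f) (mean σ.x)‖ ^ 2 + 3 * L ^ 2 * ‖σ.x i - mean σ.x‖ ^ 2 := by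
    intro i
    have h1 := norm_add_sq_le_two (gradient (globalCost f) (mean σ.x))
      (gradient (globalCost f) (σ.x i) - gradient (globalCost f) (mean σ.x))
    rw [add_sub_cancel] at h1
    have h2 := hf.norm_gradient_globalCost_sub_sq_le hn hm (σ.x i) (mean σ.x)
    linarith
  rw [avgGap, one_div_mul_eq_div, div_le_iff₀ hn']
  refine (Finset.sum_le_sum fun i _ => h i).trans (le_of_eq ?_)
  rw [Finset.sum_add_distrib, Finset.sum_const, Finset.card_univ,
    Fintype.card_fin, nsmul_eq_mul, ← Finset.mul_sum, spread]
  field_simp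

variable {W : Matrix (Fin n) (Fin n) ℝ} {α : ℝ} {σ : State n p} {v' : Fin n → E p} {e : ℕ}

/-- The invariant of gradient tracking: the columns of `W` sum to one, so mixing preserves the mean
and the increments of `v` telescope. -/
lemma mean_mix_y (hW : W ∈ doublyStochastic ℝ (Fin n)) (hσ : mean σ.y = mean σ.v) :
    mean (mix W α σ v' e).y = mean v' := by
  simp only [mix]
  rw [mean_sub (fun i => ∑ r, W i r • σ.y r + v' i), mean_add (fun i => ∑ r, W i r • σ.y r),
    mean_mixing hW, hσ, add_sub_cancel_left]

lemma mean_mix_x (hW : W ∈ doublyStochastic ℝ (Fin n)) (hσ : mean σ.y = mean σ.v) :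
    mean (mix W α σ v' e).x = mean σ.x - α • mean v' := by
  have h : mean (mix W α σ v' e).x
      = mean (fun i => ∑ r, W i r • σ.x r) - mean (fun i => α • (mix W α σ v' e).y i) :=
    mean_sub _ _
  rw [h, mean_mixing hW, mean_smul, mean_mix_y hW hσ]

lemma spread_mix_x_le (hn : 1 ≤ n) (hW : W ∈ doublyStochastic ℝ (Fin n)) (hlt : mixing W < 1) :
    spread (mix W α σ v' e).x ≤ mixing W * spread σ.x
      + α ^ 2 / (1 - mixing W) * spread (mix W α σ v' e).y := by
  set y' := (mix W α σ v' e).y with hy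
  have hm : mean (mix W α σ v' e).x = mean σ.x - α • mean y' := by
    have h : mean (mix W α σ v' e).x
        = mean (fun i => ∑ r, W i r • σ.x r) - mean (fun i => α • y' i) := mean_sub _ _
    rw [h, mean_mixing hW, mean_smul]
  have h := sum_norm_add_sq_le (fun i => ∑ r, W i r • σ.x r - mean σ.x)
    (fun i => -(α • (y' i - mean y'))) (mixing_nonneg W) hlt (sum_norm_mixing_le hn hW σ.x)
  have e1 : ∀ i, (mix W α σ v' e).x i - mean (mix W α σ v' e).x
      = (∑ r, W i r • σ.x r - mean σ.x) + -(α • (y' i - mean y')) := by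
    intro i
    have : (mix W α σ v' e).x i = ∑ r, W i r • σ.x r - α • y' i := rfl
    rw [this, hm, smul_sub]
    abel
  have e2 : ∑ i, ‖-(α • (y' i - mean y'))‖ ^ 2 = α ^ 2 * spread y' := by
    simp only [norm_neg, norm_smul, mul_pow, Real.norm_eq_abs, sq_abs, spread, Finset.mul_sum]
  rw [e2] at h
  rw [spread]
  simp only [e1]
  refine h.trans (le_of_eq ?_)
  ring

lemma spread_mix_y_le (hn : 1 ≤ n) (hW : W ∈ doublyStochastic ℝ (Fin n)) (hlt : mixing W < 1) :
    spread (mix W α σ v' e).y ≤ mixing W * spread σ.y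
      + 1 / (1 - mixing W) * ∑ i, ‖v' i - σ.v i‖ ^ 2 := by
  set d : Fin n → E p := fun i => v' i - σ.v i with hd
  have hy : ∀ i, (mix W α σ v' e).y i = ∑ r, W i r • σ.y r + d i := fun i => add_sub_assoc _ _ _
  have hm : mean (mix W α σ v' e).y = mean σ.y + mean d := by
    rw [funext hy, mean_add (fun i => ∑ r, W i r • σ.y r), mean_mixing hW]
  have h := sum_norm_add_sq_le (fun i => ∑ r, W i r • σ.y r - mean σ.y)
    (fun i => d i - mean d) (mixing_nonneg W) hlt (sum_norm_mixing_le hn hW σ.y)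
  have e1 : ∀ i, (mix W α σ v' e).y i - mean (mix W α σ v' e).y
      = (∑ r, W i r • σ.y r - mean σ.y) + (d i - mean d) := by
    intro i
    rw [hy, hm]
    abel
  rw [spread]
  simp only [e1]
  refine h.trans ?_
  have h2 := spread_le_sum hn d
  rw [spread] at h2
  have hg : 0 < 1 - mixing W := by linarith
  gcongr

/-- A node moves by its new deviation from consensus, minus its old one, plus the move of the mean.
-/
lemma moveSq_mix_le (hW : W ∈ doublyStochastic ℝ (Fin n))
    (hσ : mean σ.y = mean σ.v) :
    moveSq (mix W α σ v' e) ≤ 3 * spread (mix W α σ v' e).x + 3 * spread σ.x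
      + 3 * n * α ^ 2 * ‖mean v'‖ ^ 2 := by
  set x' := (mix W α σ v' e).x with hx
  have hm : mean x' = mean σ.x - α • mean v' := mean_mix_x hW hσ
  have h : ∀ i, ‖x' i - σ.x i‖ ^ 2 ≤ 3 * ‖x' i - mean x'‖ ^ 2 + 3 * ‖σ.x i - mean σ.x‖ ^ 2
      + 3 * (α ^ 2 * ‖mean v'‖ ^ 2) := by
    intro i
    have h1 := norm_add_three_sq_le (x' i - mean x') (-(σ.x i - mean σ.x)) (-(α • mean v'))
    have e1 : x' i - mean x' + -(σ.x i - mean σ.x) + -(α • mean v') = x' i - σ.x i := by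
      rw [hm]
      abel
    rw [e1, norm_neg, norm_neg, norm_smul, mul_pow, Real.norm_eq_abs, sq_abs] at h1
    exact h1
  have h2 := Finset.sum_le_sum fun i (_ : i ∈ Finset.univ) => h i
  rw [Finset.sum_add_distrib, Finset.sum_add_distrib, ← Finset.mul_sum, ← Finset.mul_sum,
    Finset.sum_const, Finset.card_univ, Fintype.card_fin, nsmul_eq_mul] at h2
  refine h2.trans (le_of_eq ?_)
  simp only [spread]
  ring

/-- The mean takes a step along `mean v'`, whose distance to the gradient at the mean state splits
into the mean estimator error and the effect of evaluating local gradients away from the mean. -/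
lemma SmoothCosts.globalCost_mix_le (hf : SmoothCosts f L) (hn : 1 ≤ n) (hm : 1 ≤ m)
    (hα : 0 ≤ α) (hW : W ∈ doublyStochastic ℝ (Fin n)) (hσ : mean σ.y = mean σ.v) :
    globalCost f (mean (mix W α σ v' e).x) ≤ globalCost f (mean σ.x)
      - α / 2 * ‖gradient (globalCost f) (mean σ.x)‖ ^ 2
      - α / 2 * (1 - α * L) * ‖mean v'‖ ^ 2
      + α * ‖mean (gradError f (mix W α σ v' e))‖ ^ 2 + α * (L ^ 2 / n) * spread σ.x := by
  have hn' : (0 : ℝ) < n := by positivity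
  rw [mean_mix_x hW hσ]
  refine (hf.descent hn hm (mean σ.x) (mean v')).trans ?_
  set δ : Fin n → E p :=
    fun i => gradient (localCost f i) (σ.x i) - gradient (localCost f i) (mean σ.x) with hδ
  have e1 : mean v' - gradient (globalCost f) (mean σ.x)
      = mean (gradError f (mix W α σ v' e)) + mean δ := by
    rw [gradient_globalCost hf.differentiable, ← mean_sub, ← mean_add]
    congr 1
    funext i
    simp only [gradError, mix, hδ]
    abel
  have h1 : n * ‖mean δ‖ ^ 2 ≤ L ^ 2 * spread σ.x := by
    refine (norm_mean_sq_le hn δ).trans ?_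
    rw [spread, Finset.mul_sum]
    exact Finset.sum_le_sum fun i _ => hf.norm_gradient_localCost_sub_sq_le hm i _ _
  have h2 := norm_add_sq_le_two (mean (gradError f (mix W α σ v' e))) (mean δ)
  have h3 : ‖mean δ‖ ^ 2 ≤ L ^ 2 / n * spread σ.x := by
    rw [div_mul_eq_mul_div, le_div_iff₀ hn']
    linarith
  rw [e1]
  have h4 := mul_le_mul_of_nonneg_left (h2.trans (add_le_add_right
    (mul_le_mul_of_nonneg_left h3 zero_le_two) _)) (by positivity : 0 ≤ α / 2)
  linarith

/-- The decrease of a potential in one iteration, up to the new consensus error of the gradient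
trackers and the new error of the mean gradient estimator. -/
lemma SmoothCosts.potential_mix_le (hf : SmoothCosts f L) (hn : 1 ≤ n) (hm : 1 ≤ m)
    (hα : 0 ≤ α) (hW : W ∈ doublyStochastic ℝ (Fin n)) (hlt : mixing W < 1)
    (hσ : mean σ.y = mean σ.v) {cX cY cZ : ℝ} (hcX : 0 ≤ cX) (hcZ : 0 ≤ cZ)
    (hX : (cX + 3 * cZ) * mixing W + 3 * cZ + 2 * (α * (L ^ 2 / n)) ≤ cX)
    (hY : (cX + 3 * cZ) * (α ^ 2 / (1 - mixing W)) ≤ cY * (1 - mixing W))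
    (hV : 3 * n * α ^ 2 * cZ ≤ α / 2 * (1 - α * L)) :
    globalCost f (mean (mix W α σ v' e).x) + cX * spread (mix W α σ v' e).x
        + cY * spread (mix W α σ v' e).y + cZ * moveSq (mix W α σ v' e) + α / 4 * avgGap f L σ
      ≤ globalCost f (mean σ.x) + cX * spread σ.x
        + cY * (1 + (1 - mixing W)) * spread (mix W α σ v' e).y
        + α * ‖mean (gradError f (mix W α σ v' e))‖ ^ 2 := by
  have h1 := hf.globalCost_mix_le (v' := v') (e := e) hn hm hα hW hσ
  have h2 := spread_mix_x_le (α := α) (σ := σ) (v' := v') (e := e) hn hW hlt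
  have h3 := moveSq_mix_le (α := α) (v' := v') (e := e) hW hσ
  have h4 := hf.avgGap_le hn hm σ
  set X' := spread (mix W α σ v' e).x
  set Y' := spread (mix W α σ v' e).y
  set Z' := moveSq (mix W α σ v' e)
  set V := ‖mean v'‖ ^ 2
  set X := spread σ.x
  have hX0 : 0 ≤ X := spread_nonneg _
  have hY0 : 0 ≤ Y' := spread_nonneg _
  have hV0 : 0 ≤ V := by positivity
  -- The new consensus error occurs with weight `cX` in the potential and `3 * cZ` through the last
  -- move. The gradient norm in `α / 4 * avgGap` is absorbed exactly by descent.
  have k2 := mul_le_mul_of_nonneg_left h2 (by positivity : 0 ≤ cX + 3 * cZ)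
  have k3 := mul_le_mul_of_nonneg_left h3 hcZ
  have k4 := mul_le_mul_of_nonneg_left h4 (by positivity : 0 ≤ α / 4)
  have kX := mul_le_mul_of_nonneg_right hX hX0
  have kY := mul_le_mul_of_nonneg_right hY hY0
  have kV := mul_le_mul_of_nonneg_right hV hV0
  have kL : 0 ≤ α * (L ^ 2 / n) * X := by positivity
  linarith

/-- With `g = 1 - mixing W`, contraction leaves room for the extra weight: `(1 + g) (1 - g) ≤ 1`.
The spare `cY * g` is what pays for the influence of the new tracker on the new state. -/
lemma tracker_mix_le (hn : 1 ≤ n) (hW : W ∈ doublyStochastic ℝ (Fin n)) (hlt : mixing W < 1)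
    {cY : ℝ} (hcY : 0 ≤ cY) :
    cY * (1 + (1 - mixing W)) * spread (mix W α σ v' e).y
      ≤ cY * spread σ.y + 2 * cY / (1 - mixing W) * ∑ i, ‖v' i - σ.v i‖ ^ 2 := by
  have h := spread_mix_y_le (α := α) (σ := σ) (v' := v') (e := e) hn hW hlt
  have h0 := mixing_nonneg W
  have hg : 0 < 1 - mixing W := by linarith
  have hg1 : 1 - mixing W ≤ 1 := by linarith
  set D := ∑ i, ‖v' i - σ.v i‖ ^ 2
  have hD : 0 ≤ D := Finset.sum_nonneg fun _ _ => by positivity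
  have hY := spread_nonneg σ.y
  have k := mul_le_mul_of_nonneg_left h (by positivity : 0 ≤ cY * (1 + (1 - mixing W)))
  refine k.trans ?_
  have e1 : (1 + (1 - mixing W)) * mixing W ≤ 1 := by nlinarith [sq_nonneg (1 - mixing W)]
  have e2 : (1 + (1 - mixing W)) * (1 / (1 - mixing W)) ≤ 2 / (1 - mixing W) := by
    rw [mul_one_div]
    gcongr
    linarith
  have k1 := mul_le_mul_of_nonneg_left e1 (mul_nonneg hcY hY)
  have k2 := mul_le_mul_of_nonneg_left e2 (mul_nonneg hcY hD)
  rw [mul_div_right_comm 2 cY]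
  linarith

end Iteration

/-! ### Averages over independent uniform samples -/

section Samples

/-- The average of a function on a finite type. -/
noncomputable def avg {ι : Type*} [Fintype ι] (φ : ι → ℝ) : ℝ :=
  (1 / (Fintype.card ι : ℝ)) * ∑ i, φ i

variable {ι : Type*} [Fintype ι]

lemma avg_add (φ ψ : ι → ℝ) : avg (fun i => φ i + ψ i) = avg φ + avg ψ := by
  simp [avg, Finset.sum_add_distrib, mul_add]

lemma avg_const_mul (c : ℝ) (φ : ι → ℝ) : avg (fun i => c * φ i) = c * avg φ := by
  simp only [avg, ← Finset.mul_sum]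
  ring

lemma avg_const [Nonempty ι] (c : ℝ) : avg (fun _ : ι => c) = c := by
  simp [avg]

lemma avg_mono {φ ψ : ι → ℝ} (h : ∀ i, φ i ≤ ψ i) : avg φ ≤ avg ψ :=
  mul_le_mul_of_nonneg_left (Finset.sum_le_sum fun i _ => h i) (by positivity)

lemma avg_sum {κ : Type*} (s : Finset κ) (φ : κ → ι → ℝ) :
    avg (fun i => ∑ k ∈ s, φ k i) = ∑ k ∈ s, avg (φ k) := by
  simp only [avg, ← Finset.mul_sum]
  rw [Finset.sum_comm]

variable {κ : Type*} [Fintype κ] [DecidableEq κ] {m : ℕ}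

lemma sum_pi_split (a : κ) (φ : (κ → Fin m) → ℝ) :
    ∑ θ, φ θ = ∑ ρ : {k // k ≠ a} → Fin m, ∑ j, φ ((Equiv.funSplitAt a (Fin m)).symm (j, ρ)) := by
  rw [← (Equiv.funSplitAt a (Fin m)).symm.sum_comp, Fintype.sum_prod_type, Finset.sum_comm]

lemma avg_coord (hm : 1 ≤ m) (a : κ) (φ : Fin m → ℝ) :
    avg (fun θ : κ → Fin m => φ (θ a)) = avg φ := by
  have : Nonempty (Fin m) := ⟨⟨0, hm⟩⟩
  have hcard : (Fintype.card (κ → Fin m) : ℝ)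
      = m * Fintype.card ({k // k ≠ a} → Fin m) := by
    rw [Fintype.card_congr (Equiv.funSplitAt a (Fin m)), Fintype.card_prod, Fintype.card_fin]
    push_cast
    ring
  have hpos : (Fintype.card ({k // k ≠ a} → Fin m) : ℝ) ≠ 0 := by
    exact_mod_cast Fintype.card_ne_zero
  have hm' : (m : ℝ) ≠ 0 := by positivity
  rw [avg, sum_pi_split a, hcard]
  simp only [Equiv.funSplitAt_symm_apply, dif_pos, Finset.sum_const, Finset.card_univ,
    nsmul_eq_mul, avg, Fintype.card_fin]
  field_simp

variable {V : Type*} [NormedAddCommGroup V] [InnerProductSpace ℝ V]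

/-- A centred sample is uncorrelated to everything that does not depend on it. -/
lemma avg_inner_coord_eq_zero (a : κ) {w : (κ → Fin m) → V} {g : Fin m → V}
    (hw : ∀ θ j, w (Function.update θ a j) = w θ) (hg : ∑ j, g j = 0) :
    avg (fun θ => ⟪w θ, g (θ a)⟫) = 0 := by
  rw [avg, sum_pi_split a]
  convert mul_zero _
  refine Finset.sum_eq_zero fun ρ _ => ?_
  rcases isEmpty_or_nonempty (Fin m) with h | ⟨⟨j₀⟩⟩
  · simp
  · have e1 : ∀ j, w ((Equiv.funSplitAt a (Fin m)).symm (j, ρ))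
        = w ((Equiv.funSplitAt a (Fin m)).symm (j₀, ρ)) := by
      intro j
      rw [← hw ((Equiv.funSplitAt a (Fin m)).symm (j₀, ρ)) j]
      congr 1
      funext k
      by_cases hk : k = a
      · subst hk
        simp
      · simp [hk]
    simp only [e1, ← inner_sum, Equiv.funSplitAt_symm_apply, dif_pos, hg, inner_zero_right]

/-- The second moment of a sum of independent centred samples. -/
lemma avg_norm_add_sum_sq (hm : 1 ≤ m) (c : V) {g : κ → Fin m → V}
    (hg : ∀ k, ∑ j, g k j = 0) (s : Finset κ) :
    avg (fun θ : κ → Fin m => ‖c + ∑ k ∈ s, g k (θ k)‖ ^ 2)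
      = ‖c‖ ^ 2 + ∑ k ∈ s, avg (fun j => ‖g k j‖ ^ 2) := by
  have : Nonempty (Fin m) := ⟨⟨0, hm⟩⟩
  induction s using Finset.induction_on with
  | empty => simp [avg_const]
  | insert a s ha ih =>
    have e : ∀ θ : κ → Fin m, ‖c + ∑ k ∈ insert a s, g k (θ k)‖ ^ 2
        = ‖c + ∑ k ∈ s, g k (θ k)‖ ^ 2
          + (2 * ⟪c + ∑ k ∈ s, g k (θ k), g a (θ a)⟫ + ‖g a (θ a)‖ ^ 2) := by
      intro θ
      rw [Finset.sum_insert ha, add_comm (g a (θ a)), ← add_assoc, norm_add_sq_real, add_assoc]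
    simp only [e]
    rw [avg_add, ih, avg_add, avg_const_mul, avg_coord hm a (fun j => ‖g a j‖ ^ 2),
      avg_inner_coord_eq_zero a _ (hg a), Finset.sum_insert ha]
    · ring
    · intro θ j
      congr 1
      refine Finset.sum_congr rfl fun k hk => ?_
      rw [Function.update_of_ne (by rintro rfl; exact ha hk)]

end Samples

/-! ### The gradient estimators -/

section Estimators

variable {n m p B : ℕ} {f : Fin n → Fin m → E p → ℝ} {L : ℝ}

lemma gradError_batchStep (hf : SmoothCosts f L) (W : Matrix (Fin n) (Fin n) ℝ) (α : ℝ)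
    (σ : State n p) (i : Fin n) : gradError f (batchStep f W α σ) i = 0 := by
  simp [gradError, batchStep, mix, gradient_localCost hf.differentiable, mean]

/-- The reset changes `v` by a true gradient difference minus the accumulated estimator error. -/
lemma sum_norm_batch_sub_sq_le (hf : SmoothCosts f L) (hm : 1 ≤ m)
    (W : Matrix (Fin n) (Fin n) ℝ) (α : ℝ) (σ : State n p) :
    ∑ i, ‖(batchStep f W α σ).v i - σ.v i‖ ^ 2
      ≤ 2 * L ^ 2 * moveSq σ + 2 * ∑ i, ‖gradError f σ i‖ ^ 2 := by
  rw [moveSq, Finset.mul_sum, Finset.mul_sum, ← Finset.sum_add_distrib]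
  refine Finset.sum_le_sum fun i _ => ?_
  have h0 : (batchStep f W α σ).v i = gradient (localCost f i) (σ.x i) := by
    rw [gradient_localCost hf.differentiable]
    rfl
  have h1 := norm_add_sq_le_two (gradient (localCost f i) (σ.x i)
    - gradient (localCost f i) (σ.xPrev i)) (-gradError f σ i)
  have h2 := hf.norm_gradient_localCost_sub_sq_le hm i (σ.x i) (σ.xPrev i)
  have e : gradient (localCost f i) (σ.x i) - gradient (localCost f i) (σ.xPrev i)
      + -gradError f σ i = (batchStep f W α σ).v i - σ.v i := by
    rw [h0, gradError]
    abel
  rw [e, norm_neg] at h1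
  linarith

/-- The difference of a component gradient between the last two states of a node. -/
noncomputable def gradDiff (f : Fin n → Fin m → E p → ℝ) (σ : State n p) (i : Fin n)
    (j : Fin m) : E p :=
  gradient (f i j) (σ.x i) - gradient (f i j) (σ.xPrev i)

lemma avg_norm_gradDiff_sq_le (hf : SmoothCosts f L) (σ : State n p) (i : Fin n) :
    avg (fun j => ‖gradDiff f σ i j‖ ^ 2) ≤ L ^ 2 * ‖σ.x i - σ.xPrev i‖ ^ 2 := by
  simpa [avg, gradDiff] using hf.mean_sq_smooth i (σ.x i) (σ.xPrev i)

lemma avg_norm_gradDiff_sub_mean_sq_le (hf : SmoothCosts f L) (hm : 1 ≤ m) (σ : State n p)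
    (i : Fin n) :
    avg (fun j => ‖gradDiff f σ i j - mean (gradDiff f σ i)‖ ^ 2)
      ≤ L ^ 2 * ‖σ.x i - σ.xPrev i‖ ^ 2 := by
  refine le_trans ?_ (avg_norm_gradDiff_sq_le hf σ i)
  exact mul_le_mul_of_nonneg_left (spread_le_sum hm (gradDiff f σ i)) (by positivity)

lemma sum_sub_mean (hm : 1 ≤ m) (z : Fin m → E p) : ∑ j, (z j - mean z) = 0 := by
  rw [← nsmul_mean hm, mean_sub, mean_const hm, sub_self, smul_zero]

variable (W : Matrix (Fin n) (Fin n) ℝ) (α : ℝ) (σ : State n p)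

/-- The stochastic iteration, with the samples as a single vector. -/
noncomputable def sampledStep (f : Fin n → Fin m → E p → ℝ) (θ : Fin n × Fin B → Fin m) :
    State n p :=
  sarahStep f W α (fun i l => θ (i, l)) σ

lemma sampledStep_v_sub (θ : Fin n × Fin B → Fin m) (i : Fin n) :
    (sampledStep W α σ f θ).v i - σ.v i = mean (fun l => gradDiff f σ i (θ (i, l))) := by
  simp [sampledStep, sarahStep, mix, mean, gradDiff]

/-- The martingale structure of the recursive estimator: the error changes by a sum of independent
centred terms. -/
lemma gradError_sampledStep (hf : SmoothCosts f L) (hB : 1 ≤ B) (θ : Fin n × Fin B → Fin m)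
    (i : Fin n) :
    gradError f (sampledStep W α σ f θ) i = gradError f σ i
      + ∑ l, (1 / (B : ℝ)) • (gradDiff f σ i (θ (i, l)) - mean (gradDiff f σ i)) := by
  have h1 := sampledStep_v_sub (f := f) W α σ θ i
  have h2 : mean (gradDiff f σ i)
      = gradient (localCost f i) (σ.x i) - gradient (localCost f i) (σ.xPrev i) := by
    rw [gradient_localCost hf.differentiable, gradient_localCost hf.differentiable, ← mean_sub]
    rfl
  have h3 : ∑ l, (1 / (B : ℝ)) • (gradDiff f σ i (θ (i, l)) - mean (gradDiff f σ i))
      = (sampledStep W α σ f θ).v i - σ.v i - mean (gradDiff f σ i) := by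
    rw [h1, ← Finset.smul_sum]
    change mean (fun l => gradDiff f σ i (θ (i, l)) - mean (gradDiff f σ i)) = _
    rw [mean_sub, mean_const hB]
  have h4 : (sampledStep W α σ f θ).xPrev = σ.x := rfl
  rw [h3, h2, gradError, gradError, h4]
  abel

lemma avg_sum_norm_sampledStep_v_sub_sq_le (hf : SmoothCosts f L) (hm : 1 ≤ m) (hB : 1 ≤ B) :
    avg (fun θ : Fin n × Fin B → Fin m => ∑ i, ‖(sampledStep W α σ f θ).v i - σ.v i‖ ^ 2)
      ≤ L ^ 2 * moveSq σ := by
  rw [avg_sum, moveSq, Finset.mul_sum]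
  refine Finset.sum_le_sum fun i _ => ?_
  have hB' : (B : ℝ) ≠ 0 := by positivity
  calc avg (fun θ : Fin n × Fin B → Fin m => ‖(sampledStep W α σ f θ).v i - σ.v i‖ ^ 2)
      ≤ avg (fun θ : Fin n × Fin B → Fin m =>
          (1 / (B : ℝ)) * ∑ l, ‖gradDiff f σ i (θ (i, l))‖ ^ 2) :=
        avg_mono fun θ => by
          rw [sampledStep_v_sub]
          exact norm_avg_sq_le hB _
    _ = avg (fun j => ‖gradDiff f σ i j‖ ^ 2) := by
        rw [avg_const_mul, avg_sum]
        simp only [avg_coord hm (_, _) (fun j => ‖gradDiff f σ i j‖ ^ 2)]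
        simp
        field_simp
    _ ≤ _ := avg_norm_gradDiff_sq_le hf σ i

lemma avg_norm_gradError_sampledStep_sq_le (hf : SmoothCosts f L) (hm : 1 ≤ m) (hB : 1 ≤ B)
    (i : Fin n) :
    avg (fun θ : Fin n × Fin B → Fin m => ‖gradError f (sampledStep W α σ f θ) i‖ ^ 2)
      ≤ ‖gradError f σ i‖ ^ 2 + L ^ 2 * ‖σ.x i - σ.xPrev i‖ ^ 2 := by
  have hB' : (1 : ℝ) ≤ B := by exact_mod_cast hB
  set g : Fin n × Fin B → Fin m → E p := fun k j =>
    (1 / (B : ℝ)) • (gradDiff f σ k.1 j - mean (gradDiff f σ k.1)) with hg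
  have hg0 : ∀ k, ∑ j, g k j = 0 := fun k => by
    simp only [hg]
    rw [← Finset.smul_sum, sum_sub_mean hm, smul_zero]
  have e : ∀ θ : Fin n × Fin B → Fin m, gradError f (sampledStep W α σ f θ) i
      = gradError f σ i + ∑ k ∈ {i} ×ˢ Finset.univ, g k (θ k) := by
    intro θ
    rw [gradError_sampledStep W α σ hf hB, Finset.sum_product, Finset.sum_singleton]
  simp only [e]
  rw [avg_norm_add_sum_sq hm _ hg0, Finset.sum_product, Finset.sum_singleton]
  gcongr
  have h := avg_norm_gradDiff_sub_mean_sq_le hf hm σ i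
  simp only [hg, norm_smul, mul_pow, avg_const_mul, Finset.sum_const, Finset.card_univ,
    Fintype.card_fin, nsmul_eq_mul]
  set A := avg (fun j => ‖gradDiff f σ i j - mean (gradDiff f σ i)‖ ^ 2)
  have hA : 0 ≤ A := mul_nonneg (by positivity) (Finset.sum_nonneg fun _ _ => by positivity)
  refine le_trans ?_ h
  rw [Real.norm_eq_abs, sq_abs]
  have : (B : ℝ) * ((1 / B) ^ 2 * A) = A / B := by field_simp
  rw [this]
  -- The gain `1 / B` is given up: the bound for the change of `v` carries no such factor, and both
  -- enter the potential with weights of the same order.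
  exact div_le_self hA hB'

lemma avg_sum_norm_gradError_sampledStep_sq_le (hf : SmoothCosts f L) (hm : 1 ≤ m)
    (hB : 1 ≤ B) :
    avg (fun θ : Fin n × Fin B → Fin m => ∑ i, ‖gradError f (sampledStep W α σ f θ) i‖ ^ 2)
      ≤ ∑ i, ‖gradError f σ i‖ ^ 2 + L ^ 2 * moveSq σ := by
  rw [avg_sum, moveSq, Finset.mul_sum, ← Finset.sum_add_distrib]
  exact Finset.sum_le_sum fun i _ => avg_norm_gradError_sampledStep_sq_le W α σ hf hm hB i

/-- The samples of different nodes are independent: averaging over the nodes divides the variance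
by their number. -/
lemma avg_norm_mean_gradError_sampledStep_sq_le (hf : SmoothCosts f L) (hn : 1 ≤ n) (hm : 1 ≤ m)
    (hB : 1 ≤ B) :
    avg (fun θ : Fin n × Fin B → Fin m => ‖mean (gradError f (sampledStep W α σ f θ))‖ ^ 2)
      ≤ ‖mean (gradError f σ)‖ ^ 2 + L ^ 2 / (n ^ 2 * B) * moveSq σ := by
  have hB' : (B : ℝ) ≠ 0 := by positivity
  have hn' : (n : ℝ) ≠ 0 := by positivity
  set g : Fin n × Fin B → Fin m → E p := fun k j =>
    (1 / (n * B : ℝ)) • (gradDiff f σ k.1 j - mean (gradDiff f σ k.1)) with hg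
  have hg0 : ∀ k, ∑ j, g k j = 0 := fun k => by
    simp only [hg]
    rw [← Finset.smul_sum, sum_sub_mean hm, smul_zero]
  have e : ∀ θ : Fin n × Fin B → Fin m, mean (gradError f (sampledStep W α σ f θ))
      = mean (gradError f σ) + ∑ k, g k (θ k) := by
    intro θ
    rw [funext (gradError_sampledStep W α σ hf hB θ), mean_add (gradError f σ),
      Fintype.sum_prod_type]
    congr 1
    simp only [mean, hg, Finset.smul_sum, smul_smul]
    refine Finset.sum_congr rfl fun i _ => Finset.sum_congr rfl fun l _ => ?_
    congr 1
    field_simp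
  simp only [e]
  rw [avg_norm_add_sum_sq hm _ hg0, Fintype.sum_prod_type, moveSq, Finset.mul_sum]
  gcongr with i _
  have h := avg_norm_gradDiff_sub_mean_sq_le hf hm σ i
  simp only [hg, norm_smul, mul_pow, avg_const_mul, Finset.sum_const, Finset.card_univ,
    Fintype.card_fin, nsmul_eq_mul]
  rw [Real.norm_eq_abs, sq_abs]
  calc _ ≤ (B : ℝ) * ((1 / (n * B)) ^ 2 * (L ^ 2 * ‖σ.x i - σ.xPrev i‖ ^ 2)) := by gcongr
    _ = _ := by field_simp

end Estimators

/-! ### Independence of the new samples from the current state -/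

section Paths

variable {Ω : Type*} {n m p B q : ℕ} {f : Fin n → Fin m → E p → ℝ}
  {W : Matrix (Fin n) (Fin n) ℝ} {α : ℝ} {x₀ : E p}

lemma inner_congr {τ τ' : ℕ → Fin n → Fin B → Fin m} (σ : State n p) (t : ℕ)
    (h : ∀ t', 1 ≤ t' → t' < t → τ t' = τ' t') : inner f W α τ σ t = inner f W α τ' σ t := by
  induction t with
  | zero => rfl
  | succ t ih =>
    cases t with
    | zero => rfl
    | succ t =>
      simp only [inner]
      rw [h (t + 1) (by omega) (by omega), ih fun t' h1 h2 => h t' h1 (by omega)]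

lemma outer_congr {τ τ' : ℕ → ℕ → Fin n → Fin B → Fin m} (s : ℕ)
    (h : ∀ s' t', 1 ≤ s' → s' ≤ s → 1 ≤ t' → t' ≤ q → τ s' t' = τ' s' t') :
    outer f W α q x₀ τ s = outer f W α q x₀ τ' s := by
  induction s with
  | zero => rfl
  | succ s ih =>
    simp only [outer]
    rw [ih fun s' t' h1 h2 => h s' t' h1 (by omega)]
    exact inner_congr _ _ fun t' h1 h2 => h (s + 1) t' (by omega) le_rfl h1 (by omega)

/-- The state before iteration `t` of outer loop `s + 1`. -/
noncomputable def stateAt (f : Fin n → Fin m → E p → ℝ) (W : Matrix (Fin n) (Fin n) ℝ) (α : ℝ)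
    (q : ℕ) (x₀ : E p) (τ : ℕ → ℕ → Fin n → Fin B → Fin m) (s t : ℕ) : State n p :=
  inner f W α (τ (s + 1)) (outer f W α q x₀ τ s) t

lemma stateAt_congr {τ τ' : ℕ → ℕ → Fin n → Fin B → Fin m} {s t : ℕ} (ht : t ≤ q + 1)
    (h : ∀ s' t', 1 ≤ s' → s' ≤ s + 1 → 1 ≤ t' → t' ≤ q → (s' < s + 1 ∨ t' < t) →
      τ s' t' = τ' s' t') :
    stateAt f W α q x₀ τ s t = stateAt f W α q x₀ τ' s t := by
  rw [stateAt, outer_congr s fun s' t' h1 h2 h3 h4 =>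
    h s' t' h1 (by omega) h3 h4 (Or.inl (by omega))]
  exact inner_congr _ _ fun t' h1 h2 => h (s + 1) t' (by omega) le_rfl h1 (by omega) (Or.inr h2)

/-- The indices of the samples: those of the iterations `t ≥ 1` of the outer loops `s ≥ 1`. -/
abbrev SampleIdx (n B q : ℕ) : Type :=
  {k : ℕ × ℕ × Fin n × Fin B // 1 ≤ k.1 ∧ 1 ≤ k.2.1 ∧ k.2.1 ≤ q}

/-- The samples that were drawn before iteration `t` of outer loop `s + 1`. -/
noncomputable def pastIdx (n B q s t : ℕ) : Finset (SampleIdx n B q) :=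
  (Finset.subtype _ (Finset.range (s + 2) ×ˢ Finset.range (q + 1) ×ˢ Finset.univ)).filter
    fun k => k.1.1 < s + 1 ∨ k.1.2.1 < t

lemma mem_pastIdx {s t : ℕ} {k : SampleIdx n B q} :
    k ∈ pastIdx n B q s t ↔ k.1.1 ≤ s + 1 ∧ (k.1.1 < s + 1 ∨ k.1.2.1 < t) := by
  have := k.2
  simp only [pastIdx, Finset.mem_filter, Finset.mem_subtype, Finset.mem_product,
    Finset.mem_range, Finset.mem_univ, and_true]
  omega

/-- The samples of a single path. -/
def samplePath (τ : ℕ → ℕ → Fin n → Fin B → Ω → Fin m) (ω : Ω) :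
    ℕ → ℕ → Fin n → Fin B → Fin m :=
  fun s t i l => τ s t i l ω

/-- The random samples, as a family indexed by `SampleIdx`. -/
def sampleFamily (q : ℕ) (τ : ℕ → ℕ → Fin n → Fin B → Ω → Fin m) (k : SampleIdx n B q) :
    Ω → Fin m :=
  τ k.1.1 k.1.2.1 k.1.2.2.1 k.1.2.2.2

open Classical in
/-- The state as a function of the finitely many samples that determine it. -/
lemma exists_stateAt_eq (hm : 1 ≤ m) (τ : ℕ → ℕ → Fin n → Fin B → Ω → Fin m) {s t : ℕ}
    (ht : t ≤ q + 1) :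
    ∃ Ψ : (pastIdx n B q s t → Fin m) → State n p,
      ∀ ω, stateAt f W α q x₀ (samplePath τ ω) s t = Ψ fun k => sampleFamily q τ k ω := by
  -- Indices outside the past get the arbitrary value `0`; by `stateAt_congr` they do not influence
  -- the state.
  refine ⟨fun h => stateAt f W α q x₀ (fun s' t' i l =>
    if hk : ∃ hk, (⟨(s', t', i, l), hk⟩ : SampleIdx n B q) ∈ pastIdx n B q s t then
      h ⟨⟨(s', t', i, l), hk.1⟩, hk.2⟩ else ⟨0, hm⟩) s t, fun ω => ?_⟩
  refine stateAt_congr ht fun s' t' h1 h2 h3 h4 h5 => ?_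
  funext i l
  have hk : ∃ hk, (⟨(s', t', i, l), hk⟩ : SampleIdx n B q) ∈ pastIdx n B q s t :=
    ⟨⟨h1, h3, h4⟩, mem_pastIdx.2 ⟨h2, h5⟩⟩
  rw [dif_pos hk]
  rfl

end Paths

/-! ### Conditional expectation as a finite average -/

section Tower

variable {Ω : Type*} [MeasurableSpace Ω] {μ : Measure Ω}

/-- Integrating out a uniform variable that is independent of the past. -/
lemma integral_eq_integral_avg [IsProbabilityMeasure μ] {A C : Type*} [Finite A] [MeasurableSpace A]
    [MeasurableSingletonClass A] [Fintype C] [MeasurableSpace C] [MeasurableSingletonClass C]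
    {P : Ω → A} {N : Ω → C} (hP : Measurable P) (hN : Measurable N) (hind : IndepFun P N μ)
    (hunif : ∀ c, μ.real (N ⁻¹' {c}) = 1 / (Fintype.card C : ℝ)) (φ : A → C → ℝ) :
    ∫ ω, φ (P ω) (N ω) ∂μ = ∫ ω, avg (φ (P ω)) ∂μ := by
  have := Measure.isProbabilityMeasure_map (μ := μ) hP.aemeasurable
  have := Measure.isProbabilityMeasure_map (μ := μ) hN.aemeasurable
  have h1 : ∫ ω, φ (P ω) (N ω) ∂μ = ∫ z, φ z.1 z.2 ∂(μ.map fun ω => (P ω, N ω)) :=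
    (integral_map (hP.prodMk hN).aemeasurable
      (Measurable.of_discrete (f := fun z : A × C => φ z.1 z.2)).aestronglyMeasurable).symm
  have h2 : ∫ ω, avg (φ (P ω)) ∂μ = ∫ a, avg (φ a) ∂(μ.map P) :=
    (integral_map hP.aemeasurable
      (Measurable.of_discrete (f := fun a : A => avg (φ a))).aestronglyMeasurable).symm
  rw [h1, h2, (indepFun_iff_map_prod_eq_prod_map_map hP.aemeasurable hN.aemeasurable).1 hind,
    integral_prod _ Integrable.of_finite]
  refine integral_congr_ae (ae_of_all _ fun a => ?_)
  simp only
  rw [integral_fintype Integrable.of_finite, avg, Finset.mul_sum]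
  refine Finset.sum_congr rfl fun c _ => ?_
  rw [map_measureReal_apply hN (measurableSet_singleton c), hunif, smul_eq_mul]

variable {n m p B q : ℕ} {f : Fin n → Fin m → E p → ℝ}
  {W : Matrix (Fin n) (Fin n) ℝ} {α : ℝ} {x₀ : E p}
  {τ : ℕ → ℕ → Fin n → Fin B → Ω → Fin m}

lemma IsUniformSampling.measurable_sampleFamily (hτ : IsUniformSampling μ q τ)
    (k : SampleIdx n B q) : Measurable (sampleFamily q τ k) :=
  hτ.measurable _ _ _ _ k.2.1 k.2.2.1 k.2.2.2

lemma IsUniformSampling.measurable_past (hτ : IsUniformSampling μ q τ) (s t : ℕ) :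
    Measurable fun ω (k : pastIdx n B q s t) => sampleFamily q τ k ω :=
  measurable_pi_iff.2 fun k => hτ.measurable_sampleFamily k

variable [IsProbabilityMeasure μ]

/-- The state factors through a random variable with values in a finite type, so no regularity of
`φ` or of the gradients is needed. -/
lemma IsUniformSampling.integrable_stateAt (hτ : IsUniformSampling μ q τ) (hm : 1 ≤ m)
    {s t : ℕ} (ht : t ≤ q + 1) (φ : State n p → ℝ) :
    Integrable (fun ω => φ (stateAt f W α q x₀ (samplePath τ ω) s t)) μ := by
  obtain ⟨Ψ, hΨ⟩ := exists_stateAt_eq (f := f) (W := W) (α := α) (x₀ := x₀) (s := s) hm τ ht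
  simp only [hΨ]
  have hP := hτ.measurable_past s t
  have := Measure.isProbabilityMeasure_map (μ := μ) hP.aemeasurable
  exact (Integrable.of_finite (μ := μ.map _) (f := fun h => φ (Ψ h))).comp_measurable hP

/-- The new samples are uniform, and independent of the current state. -/
lemma IsUniformSampling.integral_stateAt_succ (hτ : IsUniformSampling μ q τ) (hm : 1 ≤ m)
    {s t : ℕ} (ht1 : 1 ≤ t) (htq : t ≤ q) (φ : State n p → ℝ) :
    ∫ ω, φ (stateAt f W α q x₀ (samplePath τ ω) s (t + 1)) ∂μ
      = ∫ ω, avg (fun θ : Fin n × Fin B → Fin m =>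
          φ (sampledStep W α (stateAt f W α q x₀ (samplePath τ ω) s t) f θ)) ∂μ := by
  obtain ⟨Ψ, hΨ⟩ := exists_stateAt_eq (f := f) (W := W) (α := α) (x₀ := x₀) (s := s) hm τ
    (by omega : t ≤ q + 1)
  let idx : Fin n × Fin B → SampleIdx n B q := fun k => ⟨(s + 1, t, k.1, k.2), by omega, ht1, htq⟩
  have hidx : Function.Injective idx := by
    intro k k' h
    simp only [idx, Subtype.mk.injEq, Prod.mk.injEq, true_and] at h
    exact Prod.ext h.1 h.2
  let N : Ω → Fin n × Fin B → Fin m := fun ω k => sampleFamily q τ (idx k) ω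
  have hN : Measurable N := measurable_pi_iff.2 fun k => hτ.measurable_sampleFamily _
  have hstep : ∀ ω, stateAt f W α q x₀ (samplePath τ ω) s (t + 1)
      = sampledStep W α (stateAt f W α q x₀ (samplePath τ ω) s t) f (N ω) := by
    intro ω
    obtain ⟨t, rfl⟩ : ∃ t', t = t' + 1 := ⟨t - 1, by omega⟩
    rfl
  simp only [hstep, hΨ]
  have hindep : iIndepFun (sampleFamily q τ) μ := hτ.indep
  refine integral_eq_integral_avg (hτ.measurable_past s t) hN ?_ ?_
    (fun h θ => φ (sampledStep W α (Ψ h) f θ))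
  · classical
    -- The new samples have index `(s + 1, t)`, which lies neither in an earlier loop nor at an
    -- earlier iteration.
    have hdisj : Disjoint (pastIdx n B q s t) (Finset.univ.image idx) := by
      rw [Finset.disjoint_right]
      intro k hk
      obtain ⟨k, -, rfl⟩ := Finset.mem_image.1 hk
      simp [mem_pastIdx, idx]
    have h := hindep.indepFun_finset _ _ hdisj hτ.measurable_sampleFamily
    exact h.comp measurable_id (Measurable.of_discrete
      (f := fun (h : Finset.univ.image idx → Fin m) (k : Fin n × Fin B) =>
        h ⟨idx k, Finset.mem_image_of_mem _ (Finset.mem_univ k)⟩))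
  · intro θ
    have h := (hindep.precomp hidx).measure_inter_preimage_eq_mul Finset.univ
      (sets := fun k => {θ k}) fun _ _ => measurableSet_singleton _
    have e : N ⁻¹' {θ} = ⋂ k ∈ Finset.univ, sampleFamily q τ (idx k) ⁻¹' {θ k} := by
      ext ω
      simp [N, funext_iff]
    rw [measureReal_def, e, h]
    have hu : ∀ k, μ (sampleFamily q τ (idx k) ⁻¹' {θ k}) = (m : ℝ≥0∞)⁻¹ := fun k =>
      hτ.uniform _ _ _ _ (Nat.le_add_left 1 s) ht1 htq _
    simp [hu]

end Tower

/-! ### The potential -/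

section Potential

variable {n m p B q : ℕ}

/-- A combination of the cost of the mean state, the consensus errors, the last move and the errors
of the gradient estimators, before iteration `t` of an outer loop; at `t = 0` the estimators are
about to be reset. -/
noncomputable def potential (f : Fin n → Fin m → E p → ℝ) (q : ℕ) (α cX cY cZ cE : ℝ) (t : ℕ)
    (σ : State n p) : ℝ :=
  globalCost f (mean σ.x) + cX * spread σ.x + cY * spread σ.y + cZ * moveSq σ
    + (if t = 0 then 0 else α * (q + 1 - t)) * ‖mean (gradError f σ)‖ ^ 2
    + cE * ∑ i, ‖gradError f σ i‖ ^ 2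

/-- Coefficients for which the potential decreases; `g` is the spectral gap. -/
structure IsAdmissible (n B q : ℕ) (L α g cX cY cZ : ℝ) : Prop where
  step_nonneg : 0 ≤ α
  x_nonneg : 0 ≤ cX
  y_nonneg : 0 ≤ cY
  z_nonneg : 0 ≤ cZ
  state : (cX + 3 * cZ) * (1 - g) + 3 * cZ + 2 * (α * (L ^ 2 / n)) ≤ cX
  tracker : (cX + 3 * cZ) * (α ^ 2 / g) ≤ cY * g
  move : 3 * n * α ^ 2 * cZ ≤ α / 2 * (1 - α * L)
  error : α * q * (L ^ 2 / (n ^ 2 * B)) + 6 * cY / g * L ^ 2 ≤ cZ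

variable {f : Fin n → Fin m → E p → ℝ} {L : ℝ} {W : Matrix (Fin n) (Fin n) ℝ} {α cX cY cZ : ℝ}
  {σ : State n p}

lemma mean_mix_y_eq_mean_mix_v (hW : W ∈ doublyStochastic ℝ (Fin n)) (hσ : mean σ.y = mean σ.v)
    (v' : Fin n → E p) (e : ℕ) : mean (mix W α σ v' e).y = mean (mix W α σ v' e).v :=
  mean_mix_y hW hσ

lemma mean_inner_y (hW : W ∈ doublyStochastic ℝ (Fin n)) (hσ : mean σ.y = mean σ.v)
    (τ : ℕ → Fin n → Fin B → Fin m) (t : ℕ) :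
    mean (inner f W α τ σ t).y = mean (inner f W α τ σ t).v := by
  induction t with
  | zero => exact hσ
  | succ t ih =>
    cases t with
    | zero => exact mean_mix_y_eq_mean_mix_v hW hσ _ _
    | succ t => exact mean_mix_y_eq_mean_mix_v hW ih _ _

lemma mean_outer_y (hW : W ∈ doublyStochastic ℝ (Fin n)) (x₀ : E p)
    (τ : ℕ → ℕ → Fin n → Fin B → Fin m) (s : ℕ) :
    mean (outer f W α q x₀ τ s).y = mean (outer f W α q x₀ τ s).v := by
  induction s with
  | zero => rfl
  | succ s ih => exact mean_inner_y hW ih _ _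

lemma mean_stateAt_y (hW : W ∈ doublyStochastic ℝ (Fin n)) (x₀ : E p)
    (τ : ℕ → ℕ → Fin n → Fin B → Fin m) (s t : ℕ) :
    mean (stateAt f W α q x₀ τ s t).y = mean (stateAt f W α q x₀ τ s t).v :=
  mean_inner_y hW (mean_outer_y hW _ _ _) _ _

lemma potential_batchStep_le (hf : SmoothCosts f L) (hn : 1 ≤ n) (hm : 1 ≤ m)
    (hW : W ∈ doublyStochastic ℝ (Fin n)) (hlt : mixing W < 1)
    (hc : IsAdmissible n B q L α (1 - mixing W) cX cY cZ) (hσ : mean σ.y = mean σ.v) :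
    potential f q α cX cY cZ (4 * cY / (1 - mixing W)) 1 (batchStep f W α σ)
        + α / 4 * avgGap f L σ
      ≤ potential f q α cX cY cZ (4 * cY / (1 - mixing W)) 0 σ := by
  have hg : 0 < 1 - mixing W := by linarith
  have hY := hc.y_nonneg
  have h1 := hf.potential_mix_le (v' := fun i => (1 / (m : ℝ)) • ∑ j, gradient (f i j) (σ.x i))
    (e := n * m) hn hm hc.step_nonneg hW hlt hσ hc.x_nonneg hc.z_nonneg
    (by linarith [hc.state]) hc.tracker hc.move
  have h2 := tracker_mix_le (α := α) (σ := σ)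
    (v' := fun i => (1 / (m : ℝ)) • ∑ j, gradient (f i j) (σ.x i)) (e := n * m) hn hW hlt hY
  have h3 := sum_norm_batch_sub_sq_le hf hm W α σ
  have h4 := mul_le_mul_of_nonneg_left h3 (by positivity : 0 ≤ 2 * cY / (1 - mixing W))
  change globalCost f (mean (batchStep f W α σ).x) + _ * spread (batchStep f W α σ).x
    + _ * spread (batchStep f W α σ).y + _ * moveSq (batchStep f W α σ) + _ ≤
    _ + _ + _ * spread (batchStep f W α σ).y
      + α * ‖mean (gradError f (batchStep f W α σ))‖ ^ 2 at h1
  change _ * spread (batchStep f W α σ).y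
    ≤ _ + _ * ∑ i, ‖(batchStep f W α σ).v i - σ.v i‖ ^ 2 at h2
  have e0 : ∀ i, gradError f (batchStep f W α σ) i = 0 := gradError_batchStep hf W α σ
  have e1 : mean (gradError f (batchStep f W α σ)) = 0 := by
    rw [funext e0]
    exact mean_const hn 0
  have e2 : ∑ i, ‖gradError f (batchStep f W α σ) i‖ ^ 2 = 0 := by simp [e0]
  simp only [potential, e1, e2, norm_zero, if_true] at h1 ⊢
  -- The full-gradient step needs only part of the condition `error`; the constant 6 there comes
  -- from the stochastic steps.
  have hZ : 4 * cY / (1 - mixing W) * L ^ 2 ≤ cZ := by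
    have := hc.error
    have h5 : 0 ≤ α * q * (L ^ 2 / (n ^ 2 * B)) := by
      have := hc.step_nonneg
      positivity
    have h6 : 4 * cY / (1 - mixing W) * L ^ 2 ≤ 6 * cY / (1 - mixing W) * L ^ 2 := by
      gcongr
      norm_num
    linarith
  have h7 := mul_le_mul_of_nonneg_right hZ (moveSq_nonneg σ)
  have e3 : 2 * cY / (1 - mixing W) * (2 * L ^ 2 * moveSq σ + 2 * ∑ i, ‖gradError f σ i‖ ^ 2)
      = 4 * cY / (1 - mixing W) * L ^ 2 * moveSq σ
        + 4 * cY / (1 - mixing W) * ∑ i, ‖gradError f σ i‖ ^ 2 := by ring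
  rw [e3] at h4
  simp only [ne_eq, OfNat.ofNat_ne_zero, not_false_eq_true, zero_pow, mul_zero, zero_mul,
    add_zero] at h1 ⊢
  linarith

/-- The first iteration is treated apart: there the trackers become the local gradients at `x₀`.
Using `potential_batchStep_le` would instead charge the estimator error of `v = 0` with weight `4 *
cY / (1 - mixing W)`, losing a factor of the order of the inverse spectral gap. -/
lemma potential_batchStep_initState_le (hf : SmoothCosts f L) (hn : 1 ≤ n) (hm : 1 ≤ m)
    (hW : W ∈ doublyStochastic ℝ (Fin n)) (hlt : mixing W < 1)
    (hc : IsAdmissible n B q L α (1 - mixing W) cX cY cZ) (x₀ : E p) (cE : ℝ) :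
    potential f q α cX cY cZ cE 1 (batchStep f W α (initState x₀))
        + α / 4 * avgGap f L (initState (n := n) x₀)
      ≤ globalCost f x₀ + 2 * cY * ∑ i, ‖gradient (localCost f i) x₀‖ ^ 2 := by
  have hY := hc.y_nonneg
  set σ : State n p := initState x₀ with hσ
  have h1 := hf.potential_mix_le (v' := fun i => (1 / (m : ℝ)) • ∑ j, gradient (f i j) (σ.x i))
    (e := n * m) hn hm hc.step_nonneg hW hlt (show mean σ.y = mean σ.v from rfl) hc.x_nonneg
    hc.z_nonneg (by linarith [hc.state]) hc.tracker hc.move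
  change globalCost f (mean (batchStep f W α σ).x) + _ * spread (batchStep f W α σ).x
    + _ * spread (batchStep f W α σ).y + _ * moveSq (batchStep f W α σ) + _ ≤
    _ + _ + _ * spread (batchStep f W α σ).y
      + α * ‖mean (gradError f (batchStep f W α σ))‖ ^ 2 at h1
  have e0 : ∀ i, gradError f (batchStep f W α σ) i = 0 := gradError_batchStep hf W α σ
  have e1 : mean (gradError f (batchStep f W α σ)) = 0 := by
    rw [funext e0]
    exact mean_const hn 0
  have e2 : ∑ i, ‖gradError f (batchStep f W α σ) i‖ ^ 2 = 0 := by simp [e0]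
  have e3 : mean σ.x = x₀ := mean_const hn x₀
  have e4 : spread σ.x = 0 := by
    simp only [spread, e3]
    simp [hσ, initState]
  have e5 : ∀ i, (batchStep f W α σ).y i = gradient (localCost f i) x₀ := by
    intro i
    rw [gradient_localCost hf.differentiable]
    simp [batchStep, mix, hσ, initState, mean]
  have h2 : spread (batchStep f W α σ).y ≤ ∑ i, ‖gradient (localCost f i) x₀‖ ^ 2 := by
    have := spread_le_sum hn (batchStep f W α σ).y
    simpa only [e5] using this
  have h3 : cY * (1 + (1 - mixing W)) * spread (batchStep f W α σ).y
      ≤ 2 * cY * ∑ i, ‖gradient (localCost f i) x₀‖ ^ 2 := by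
    have h0 := mixing_nonneg W
    have h5 : cY * (1 + (1 - mixing W)) ≤ 2 * cY := by nlinarith
    exact mul_le_mul h5 h2 (spread_nonneg _) (by positivity)
  simp only [potential, e1, e2, e3, e4, norm_zero, ne_eq, OfNat.ofNat_ne_zero,
    not_false_eq_true, zero_pow, mul_zero, add_zero] at h1 ⊢
  linarith

lemma avg_potential_sampledStep_le (hf : SmoothCosts f L) (hn : 1 ≤ n) (hm : 1 ≤ m)
    (hB : 1 ≤ B) (hW : W ∈ doublyStochastic ℝ (Fin n)) (hlt : mixing W < 1)
    (hc : IsAdmissible n B q L α (1 - mixing W) cX cY cZ) (hσ : mean σ.y = mean σ.v) {t : ℕ}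
    (ht1 : 1 ≤ t) (htq : t ≤ q) :
    avg (fun θ : Fin n × Fin B → Fin m =>
        potential f q α cX cY cZ (4 * cY / (1 - mixing W)) (t + 1) (sampledStep W α σ f θ))
        + α / 4 * avgGap f L σ
      ≤ potential f q α cX cY cZ (4 * cY / (1 - mixing W)) t σ := by
  have : Nonempty (Fin m) := ⟨⟨0, hm⟩⟩
  have hg : 0 < 1 - mixing W := by linarith
  have hY := hc.y_nonneg
  have hα := hc.step_nonneg
  have ht1' : (1 : ℝ) ≤ t := by exact_mod_cast ht1
  have htq' : (t : ℝ) ≤ q := by exact_mod_cast htq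
  set c := 4 * cY / (1 - mixing W) with hcdef
  have hc0 : 0 ≤ c := by positivity
  set base := globalCost f (mean σ.x) + cX * spread σ.x + cY * spread σ.y
    - α / 4 * avgGap f L σ with hbase
  have hθ : ∀ θ : Fin n × Fin B → Fin m,
      potential f q α cX cY cZ c (t + 1) (sampledStep W α σ f θ)
        ≤ base + (c / 2 * ∑ i, ‖(sampledStep W α σ f θ).v i - σ.v i‖ ^ 2
          + (α * (q + 1 - t) * ‖mean (gradError f (sampledStep W α σ f θ))‖ ^ 2
            + c * ∑ i, ‖gradError f (sampledStep W α σ f θ) i‖ ^ 2)) := by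
    intro θ
    have e : sampledStep W α σ f θ = mix W α σ (sampledStep W α σ f θ).v (n * (2 * B)) := rfl
    have h1 := hf.potential_mix_le (v' := (sampledStep W α σ f θ).v) (e := n * (2 * B)) hn hm hα
      hW hlt hσ hc.x_nonneg hc.z_nonneg (by linarith [hc.state]) hc.tracker hc.move
    have h2 := tracker_mix_le (α := α) (σ := σ) (v' := (sampledStep W α σ f θ).v)
      (e := n * (2 * B)) hn hW hlt hY
    rw [← e] at h1 h2
    have e1 : 2 * cY / (1 - mixing W) = c / 2 := by rw [hcdef]; ring
    rw [e1] at h2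
    simp only [potential, Nat.add_eq_zero_iff, one_ne_zero, and_false, if_false]
    push_cast
    -- The falling weight: the `α` released here cancels the error charged by descent.
    have e2 : α * ((q : ℝ) + 1 - (t + 1)) * ‖mean (gradError f (sampledStep W α σ f θ))‖ ^ 2
        = α * (q + 1 - t) * ‖mean (gradError f (sampledStep W α σ f θ))‖ ^ 2
          - α * ‖mean (gradError f (sampledStep W α σ f θ))‖ ^ 2 := by ring
    rw [e2, hbase]
    linarith
  have h := avg_mono hθ
  rw [avg_add, avg_const, avg_add, avg_const_mul, avg_add, avg_const_mul, avg_const_mul] at h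
  have k1 := mul_le_mul_of_nonneg_left
    (avg_sum_norm_sampledStep_v_sub_sq_le W α σ hf hm hB) (by positivity : 0 ≤ c / 2)
  have hp : 0 ≤ α * ((q : ℝ) + 1 - t) := mul_nonneg hα (by linarith)
  have k2 := mul_le_mul_of_nonneg_left
    (avg_norm_mean_gradError_sampledStep_sq_le W α σ hf hn hm hB) hp
  have k3 := mul_le_mul_of_nonneg_left
    (avg_sum_norm_gradError_sampledStep_sq_le W α σ hf hm hB) hc0
  -- The last move pays for three things: the jump of the trackers, the variance of the mean error,
  -- and that of the individual errors. Since `1 ≤ t`, the remaining weight is at most `α * q`.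
  have hZ : c / 2 * L ^ 2 + α * (q + 1 - t) * (L ^ 2 / (n ^ 2 * B)) + c * L ^ 2 ≤ cZ := by
    refine le_trans ?_ hc.error
    have e1 : 6 * cY / (1 - mixing W) * L ^ 2 = c / 2 * L ^ 2 + c * L ^ 2 := by rw [hcdef]; ring
    have e2 : α * ((q : ℝ) + 1 - t) * (L ^ 2 / (n ^ 2 * B)) ≤ α * q * (L ^ 2 / (n ^ 2 * B)) := by
      gcongr
      linarith
    linarith
  have k4 := mul_le_mul_of_nonneg_right hZ (moveSq_nonneg σ)
  have ht0 : t ≠ 0 := by omega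
  have e : potential f q α cX cY cZ c t σ = globalCost f (mean σ.x) + cX * spread σ.x
      + cY * spread σ.y + cZ * moveSq σ + α * (q + 1 - t) * ‖mean (gradError f σ)‖ ^ 2
      + c * ∑ i, ‖gradError f σ i‖ ^ 2 := by
    simp only [potential, if_neg ht0]
  rw [e]
  linarith

end Potential

/-! ### Convergence -/

section Convergence

variable {Ω : Type*} [MeasurableSpace Ω] {μ : Measure Ω} [IsProbabilityMeasure μ]
  {n m p B q : ℕ} {f : Fin n → Fin m → E p → ℝ} {L : ℝ} {W : Matrix (Fin n) (Fin n) ℝ}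
  {α cX cY cZ : ℝ} {x₀ : E p} {τ : ℕ → ℕ → Fin n → Fin B → Ω → Fin m}

/-- The weight `α * (q + 1 - t)` has run out at `t = q + 1`, so consecutive outer loops fit
together. -/
lemma potential_last (cE : ℝ) (σ : State n p) :
    potential f q α cX cY cZ cE (q + 1) σ = potential f q α cX cY cZ cE 0 σ := by
  simp [potential]

lemma integral_potential_succ_le (hf : SmoothCosts f L) (hn : 1 ≤ n) (hm : 1 ≤ m)
    (hB : 1 ≤ B) (hW : W ∈ doublyStochastic ℝ (Fin n)) (hlt : mixing W < 1)
    (hc : IsAdmissible n B q L α (1 - mixing W) cX cY cZ) (hτ : IsUniformSampling μ q τ)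
    (s : ℕ) {t : ℕ} (htq : t ≤ q) :
    ∫ ω, potential f q α cX cY cZ (4 * cY / (1 - mixing W)) (t + 1)
        (stateAt f W α q x₀ (samplePath τ ω) s (t + 1)) ∂μ
        + α / 4 * ∫ ω, avgGap f L (stateAt f W α q x₀ (samplePath τ ω) s t) ∂μ
      ≤ ∫ ω, potential f q α cX cY cZ (4 * cY / (1 - mixing W)) t
        (stateAt f W α q x₀ (samplePath τ ω) s t) ∂μ := by
  have hint : ∀ t ≤ q + 1, ∀ φ : State n p → ℝ, Integrable
      (fun ω => φ (stateAt f W α q x₀ (samplePath τ ω) s t)) μ := fun t ht φ =>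
    hτ.integrable_stateAt hm ht φ
  have hbal := fun ω => mean_stateAt_y (f := f) (α := α) (q := q) hW x₀ (samplePath τ ω) s t
  rw [← integral_const_mul]
  rcases Nat.eq_zero_or_pos t with rfl | ht
  · rw [← integral_add (hint _ (by omega) _)
      (hint 0 (by omega) fun σ => α / 4 * avgGap f L σ)]
    refine integral_mono ((hint _ (by omega) _).add
      (hint 0 (by omega) fun σ => α / 4 * avgGap f L σ)) (hint _ (by omega) _) fun ω => ?_
    exact potential_batchStep_le hf hn hm hW hlt hc (hbal ω)
  · rw [hτ.integral_stateAt_succ hm ht htq, ← integral_add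
      (hint t (by omega) fun σ => avg fun θ : Fin n × Fin B → Fin m => potential f q α cX cY cZ _
        (t + 1) (sampledStep W α σ f θ)) (hint t (by omega) fun σ => α / 4 * avgGap f L σ)]
    refine integral_mono ((hint t (by omega) fun σ => avg fun θ : Fin n × Fin B → Fin m =>
      potential f q α cX cY cZ _ (t + 1) (sampledStep W α σ f θ)).add
      (hint t (by omega) fun σ => α / 4 * avgGap f L σ)) (hint _ (by omega) _) fun ω => ?_
    exact avg_potential_sampledStep_le hf hn hm hB hW hlt hc (hbal ω) ht htq

lemma integral_potential_init_le (hf : SmoothCosts f L) (hn : 1 ≤ n) (hm : 1 ≤ m)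
    (hW : W ∈ doublyStochastic ℝ (Fin n)) (hlt : mixing W < 1)
    (hc : IsAdmissible n B q L α (1 - mixing W) cX cY cZ) (cE : ℝ) :
    ∫ ω, potential f q α cX cY cZ cE 1 (stateAt f W α q x₀ (samplePath τ ω) 0 1) ∂μ
        + α / 4 * ∫ ω, avgGap f L (stateAt f W α q x₀ (samplePath τ ω) 0 0) ∂μ
      ≤ globalCost f x₀ + 2 * cY * ∑ i, ‖gradient (localCost f i) x₀‖ ^ 2 := by
  have h := potential_batchStep_initState_le hf hn hm hW hlt hc x₀ cE
  have e1 : ∀ ω, stateAt f W α q x₀ (samplePath τ ω) 0 1 = batchStep f W α (initState x₀) :=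
    fun _ => rfl
  have e2 : ∀ ω, stateAt f W α q x₀ (samplePath τ ω) 0 0 = initState x₀ := fun _ => rfl
  simpa [e1, e2] using h

lemma sum_integral_avgGap_le (hf : SmoothCosts f L) (hn : 1 ≤ n) (hm : 1 ≤ m)
    (hB : 1 ≤ B) (hW : W ∈ doublyStochastic ℝ (Fin n)) (hlt : mixing W < 1)
    (hc : IsAdmissible n B q L α (1 - mixing W) cX cY cZ) (hτ : IsUniformSampling μ q τ)
    (S : ℕ) :
    α / 4 * ∑ s ∈ Finset.range (S + 1), ∑ t ∈ Finset.range (q + 1),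
        ∫ ω, avgGap f L (stateAt f W α q x₀ (samplePath τ ω) s t) ∂μ
      ≤ globalCost f x₀ - (⨅ x, globalCost f x)
        + 2 * cY * ∑ i, ‖gradient (localCost f i) x₀‖ ^ 2 := by
  set c := 4 * cY / (1 - mixing W) with hcdef
  set D := globalCost f x₀ + 2 * cY * ∑ i, ‖gradient (localCost f i) x₀‖ ^ 2 with hD
  set P : ℕ → ℕ → ℝ := fun s t => ∫ ω, potential f q α cX cY cZ c t
        (stateAt f W α q x₀ (samplePath τ ω) s t) ∂μ with hP
  set A : ℕ → ℕ → ℝ := fun s t =>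
    ∫ ω, avgGap f L (stateAt f W α q x₀ (samplePath τ ω) s t) ∂μ with hA
  have hstep : ∀ s t, t ≤ q → P s (t + 1) + α / 4 * A s t ≤ P s t := fun s t ht =>
    integral_potential_succ_le hf hn hm hB hW hlt hc hτ s ht
  have hloop : ∀ s t, t ≤ q + 1 → P s t + α / 4 * ∑ t' ∈ Finset.range t, A s t' ≤ P s 0 := by
    intro s t ht
    induction t with
    | zero => simp
    | succ t ih =>
      rw [Finset.sum_range_succ, mul_add]
      linarith [ih (by omega), hstep s t (by omega)]
  -- In the first loop the sum starts from the sharper bound `D` instead of `P 0 0`.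
  have hfirst : ∀ t, t ≤ q → P 0 (t + 1) + α / 4 * ∑ t' ∈ Finset.range (t + 1), A 0 t' ≤ D := by
    intro t ht
    induction t with
    | zero => simpa using integral_potential_init_le hf hn hm hW hlt hc c
    | succ t ih =>
      rw [Finset.sum_range_succ, mul_add]
      linarith [ih (by omega), hstep 0 (t + 1) ht]
  have hnext : ∀ s, P (s + 1) 0 = P s (q + 1) := fun s => by
    simp only [hP, potential_last]
    rfl
  have hall : ∀ S, P S (q + 1) + α / 4 * ∑ s ∈ Finset.range (S + 1),
      ∑ t ∈ Finset.range (q + 1), A s t ≤ D := by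
    intro S
    induction S with
    | zero => simpa using hfirst q le_rfl
    | succ S ih =>
      rw [Finset.sum_range_succ, mul_add]
      linarith [hloop (S + 1) (q + 1) le_rfl, hnext S]
  have hlow : (⨅ x, globalCost f x) ≤ P S (q + 1) := by
    have hint : Integrable (fun ω => potential f q α cX cY cZ c (q + 1)
      (stateAt f W α q x₀ (samplePath τ ω) S (q + 1))) μ := hτ.integrable_stateAt hm le_rfl _
    have := integral_mono (integrable_const (⨅ x, globalCost f x)) hint fun ω => by
      set σ := stateAt f W α q x₀ (samplePath τ ω) S (q + 1)
      have h1 := ciInf_le hf.bddBelow (mean σ.x)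
      have h2 := mul_nonneg hc.x_nonneg (spread_nonneg σ.x)
      have h3 := mul_nonneg hc.y_nonneg (spread_nonneg σ.y)
      have h4 := mul_nonneg hc.z_nonneg (moveSq_nonneg σ)
      have h5 : 0 ≤ c * ∑ i, ‖gradError f σ i‖ ^ 2 := by
        refine mul_nonneg ?_ (Finset.sum_nonneg fun _ _ => by positivity)
        have := hc.y_nonneg
        have hg : 0 < 1 - mixing W := by linarith
        positivity
      simp only [potential_last]
      simp only [potential, if_true]
      linarith
    simpa using this
  linarith [hall S]

lemma sum_Icc_one_eq (g : ℕ → ℝ) (S : ℕ) :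
    ∑ s ∈ Finset.Icc 1 S, g s = ∑ s ∈ Finset.range S, g (s + 1) := by
  rw [Finset.range_eq_Ico, Finset.sum_Ico_add' g 0 S 1]
  refine Finset.sum_congr ?_ fun _ _ => rfl
  ext s
  simp

/-- The accuracy after `S` outer loops, in terms of the states. -/
lemma findsIn_of_sum_le (hm : 1 ≤ m) (hτ : IsUniformSampling μ q τ) {ε : ℝ} {S : ℕ}
    (h : 1 / ((S : ℝ) * ((q : ℝ) + 1)) * ∑ s ∈ Finset.range S, ∑ t ∈ Finset.range (q + 1),
        ∫ ω, avgGap f L (stateAt f W α q x₀ (samplePath τ ω) s t) ∂μ ≤ ε ^ 2) :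
    FindsIn f W L α q x₀ μ τ ε S := by
  have hgap : ∀ s t i, gap f W L α q x₀ τ t (s + 1) i = fun ω =>
      ‖gradient (globalCost f) ((stateAt f W α q x₀ (samplePath τ ω) s t).x i)‖ ^ 2
        + L ^ 2 * ‖(stateAt f W α q x₀ (samplePath τ ω) s t).x i
          - mean (stateAt f W α q x₀ (samplePath τ ω) s t).x‖ ^ 2 := fun s t i => rfl
  have hint : ∀ s t, t ≤ q → ∀ i, Integrable (gap f W L α q x₀ τ t (s + 1) i) μ := by
    intro s t ht i
    rw [hgap]
    exact hτ.integrable_stateAt hm (by omega : t ≤ q + 1) fun σ =>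
      ‖gradient (globalCost f) (σ.x i)‖ ^ 2 + L ^ 2 * ‖σ.x i - mean σ.x‖ ^ 2
  refine ⟨fun s hs t ht i => ?_, ?_⟩
  · obtain ⟨s, rfl⟩ : ∃ s', s = s' + 1 := ⟨s - 1, by grind⟩
    exact hint s t (by grind) i
  · refine le_trans (le_of_eq ?_) h
    congr 1
    rw [sum_Icc_one_eq]
    refine Finset.sum_congr rfl fun s _ => Finset.sum_congr rfl fun t ht => ?_
    rw [← integral_finsetSum _ fun i _ => hint s t (by grind) i, ← integral_const_mul]
    rfl

end Convergence

/-! ### The complexity bounds -/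

section Bounds

/-- Writing `n = ν ^ 6`, `m = μ ^ 6`, `B = β ^ 3` and, where needed, `g = γ ^ 2` turns all
fractional powers below into natural ones. -/
lemma exists_pow_eq {x : ℝ} (hx : 0 < x) {k : ℕ} (hk : k ≠ 0) : ∃ y, 0 < y ∧ x = y ^ k :=
  ⟨x ^ (1 / (k : ℝ)), by positivity, by
    rw [← Real.rpow_natCast, ← Real.rpow_mul hx.le, one_div_mul_cancel (by exact_mod_cast hk),
      Real.rpow_one]⟩

lemma pow_rpow_eq {y : ℝ} (hy : 0 ≤ y) {k l : ℕ} {r : ℝ} (h : k * r = l) :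
    (y ^ k) ^ r = y ^ l := by
  rw [← Real.rpow_natCast, ← Real.rpow_mul hy, h, Real.rpow_natCast]

variable {n m B : ℕ} {g ν μ β γ : ℝ}

lemma gradBound_eq (hν : 0 ≤ ν) (hμ : 0 ≤ μ) (hβ : 0 ≤ β) (hn : (n : ℝ) = ν ^ 6)
    (hm : (m : ℝ) = μ ^ 6) (hB : (B : ℝ) = β ^ 3) :
    gradBound n m B g
      = max (ν ^ 6 * β ^ 3 / g ^ 2) (max (ν ^ 3 * μ ^ 3) (μ ^ 2 * ν ^ 4 * β / g)) := by
  rw [gradBound, Nat.cast_mul, hn, hm, hB, Real.mul_rpow (by positivity) (by positivity),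
    pow_rpow_eq (l := 3) hν (by norm_num), pow_rpow_eq (l := 3) hμ (by norm_num),
    pow_rpow_eq (l := 2) hμ (by norm_num), pow_rpow_eq (l := 4) hν (by norm_num),
    pow_rpow_eq (l := 1) hβ (by norm_num), pow_one]

lemma commBound_eq (hν : 0 ≤ ν) (hμ : 0 ≤ μ) (hβ : 0 ≤ β) (hn : (n : ℝ) = ν ^ 6)
    (hm : (m : ℝ) = μ ^ 6) (hB : (B : ℝ) = β ^ 3) :
    commBound n m B g
      = max (1 / g ^ 2) (max (μ ^ 3 / (ν ^ 3 * β ^ 3)) (μ ^ 2 / (ν ^ 2 * β ^ 2 * g))) := by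
  rw [commBound, hn, hm, hB, pow_rpow_eq (l := 3) hν (by norm_num),
    pow_rpow_eq (l := 3) hμ (by norm_num), pow_rpow_eq (l := 2) hμ (by norm_num),
    pow_rpow_eq (l := 2) hν (by norm_num), pow_rpow_eq (l := 2) hβ (by norm_num)]

lemma stepScale_eq {L : ℝ} (hν : 0 ≤ ν) (hμ : 0 ≤ μ) (hβ : 0 ≤ β) (hn : (n : ℝ) = ν ^ 6)
    (hm : (m : ℝ) = μ ^ 6) (hB : (B : ℝ) = β ^ 3) :
    stepScale n m B g L
      = min (g ^ 2) (min (ν ^ 3 * β ^ 3 / μ ^ 3) (ν ^ 2 * β ^ 2 * g / μ ^ 2)) * (1 / L) := by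
  rw [stepScale, hn, hm, hB, pow_rpow_eq (l := 3) hν (by norm_num),
    pow_rpow_eq (l := 3) hμ (by norm_num), pow_rpow_eq (l := 2) hμ (by norm_num),
    pow_rpow_eq (l := 2) hν (by norm_num), pow_rpow_eq (l := 2) hβ (by norm_num)]

lemma boundHR_eq (hν : 0 ≤ ν) (hμ : 0 ≤ μ) (hn : (n : ℝ) = ν ^ 6) (hm : (m : ℝ) = μ ^ 6) :
    boundHR n m g = max (ν ^ 6 / g ^ 2) (max (ν ^ 3 * μ ^ 3) (μ ^ 2 * ν ^ 4 / g)) := by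
  rw [boundHR, Nat.cast_mul, hn, hm, Real.mul_rpow (by positivity) (by positivity),
    pow_rpow_eq (l := 3) hν (by norm_num), pow_rpow_eq (l := 3) hμ (by norm_num),
    pow_rpow_eq (l := 2) hμ (by norm_num), pow_rpow_eq (l := 4) hν (by norm_num)]

lemma boundHC_eq (hν : 0 ≤ ν) (hμ : 0 ≤ μ) (hγ : 0 ≤ γ) (hn : (n : ℝ) = ν ^ 6)
    (hm : (m : ℝ) = μ ^ 6) (hg : g = γ ^ 2) :
    boundHC n m g
      = max (ν ^ 6 / γ ^ 4) (max (ν ^ 3 * μ ^ 3 / γ) (μ ^ 2 * ν ^ 4 / γ ^ 2)) := by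
  rw [boundHC, Nat.cast_mul, hn, hm, hg, Real.mul_rpow (by positivity) (by positivity),
    pow_rpow_eq (l := 3) hν (by norm_num), pow_rpow_eq (l := 3) hμ (by norm_num),
    pow_rpow_eq (l := 2) hμ (by norm_num), pow_rpow_eq (l := 4) hν (by norm_num),
    pow_rpow_eq (l := 1) hγ (by norm_num), pow_one, ← pow_mul]

lemma boundKR_eq (hν : 0 ≤ ν) (hμ : 0 ≤ μ) (hn : (n : ℝ) = ν ^ 6) (hm : (m : ℝ) = μ ^ 6) :
    boundKR n m g = max (1 / g ^ 2)
      (max (min (μ ^ 3 / ν ^ 3) (1 / g ^ 3)) (min (μ ^ 2 / (ν ^ 2 * g)) (1 / g ^ 3))) := by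
  rw [boundKR, hn, hm, pow_rpow_eq (l := 3) hν (by norm_num),
    pow_rpow_eq (l := 3) hμ (by norm_num), pow_rpow_eq (l := 2) hμ (by norm_num),
    pow_rpow_eq (l := 2) hν (by norm_num)]

lemma thresholdR_eq (hν : 0 < ν) (hμ : 0 ≤ μ) (hn : (n : ℝ) = ν ^ 6) (hm : (m : ℝ) = μ ^ 6) :
    thresholdR n m g = max ((μ * g / ν) ^ 3) 1 := by
  rw [thresholdR, hn, hm, Real.rpow_neg (by positivity), pow_rpow_eq (l := 3) hν.le (by norm_num),
    pow_rpow_eq (l := 3) hμ (by norm_num)]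
  congr 1
  field_simp

lemma thresholdC_eq (hν : 0 < ν) (hμ : 0 ≤ μ) (hγ : 0 ≤ γ) (hn : (n : ℝ) = ν ^ 6)
    (hm : (m : ℝ) = μ ^ 6) (hg : g = γ ^ 2) :
    thresholdC n m g = max ((μ * γ / ν) ^ 3) 1 := by
  rw [thresholdC, hn, hm, hg, Real.rpow_neg (by positivity),
    pow_rpow_eq (l := 3) hν.le (by norm_num), pow_rpow_eq (l := 3) hμ (by norm_num),
    pow_rpow_eq (l := 3) hγ (by norm_num)]
  congr 1
  field_simp

/-- A rational stand-in for the cube root of 2, as `2 ≤ (4 / 3) ^ 3`; its square is still below 2.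
-/
lemma le_four_thirds_mul {s b : ℝ} (hb : 0 ≤ b) (h : s ^ 3 ≤ 2 * b ^ 3) : s ≤ 4 / 3 * b := by
  refine le_of_pow_le_pow_left₀ three_ne_zero (by positivity) (h.trans ?_)
  have : 0 ≤ b ^ 3 := by positivity
  rw [mul_pow]
  linarith

lemma boundHR_le_gradBound (hn : 1 ≤ n) (hm : 1 ≤ m) (hB : 1 ≤ B) (hg : 0 < g) :
    boundHR n m g ≤ gradBound n m B g := by
  obtain ⟨ν, hν, en⟩ := exists_pow_eq (by positivity : (0 : ℝ) < n) (k := 6) (by norm_num)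
  obtain ⟨μ, hμ, em⟩ := exists_pow_eq (by positivity : (0 : ℝ) < m) (k := 6) (by norm_num)
  obtain ⟨β, hβ, eB⟩ := exists_pow_eq (by positivity : (0 : ℝ) < B) (k := 3) (by norm_num)
  have hB' : (1 : ℝ) ≤ B := by exact_mod_cast hB
  have hβ3 : 1 ≤ β ^ 3 := eB ▸ hB'
  have hβ1 : 1 ≤ β := (one_le_pow_iff_of_nonneg hβ.le three_ne_zero).1 hβ3
  rw [boundHR_eq hν.le hμ.le en em, gradBound_eq hν.le hμ.le hβ.le en em eB]
  refine max_le_max ?_ (max_le_max le_rfl ?_)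
  · gcongr
    exact le_mul_of_one_le_right (by positivity) hβ3
  · refine div_le_div_of_nonneg_right ?_ hg.le
    exact le_mul_of_one_le_right (by positivity) hβ1

/-- At `B = m^{1/2} n^{-1/2} g³` the third term of `gradBound` equals `N^{1/2}`. Up to there both
terms that grow with `B` are dominated by `N^{1/2}`; otherwise `B ≤ 1` and the terms are compared
one by one. -/
lemma gradBound_le_boundHR (hn : 1 ≤ n) (hm : 1 ≤ m) (hB : 1 ≤ B) (hg : 0 < g) (hg1 : g ≤ 1)
    (h : (B : ℝ) ≤ thresholdR n m g) : gradBound n m B g ≤ boundHR n m g := by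
  obtain ⟨ν, hν, en⟩ := exists_pow_eq (by positivity : (0 : ℝ) < n) (k := 6) (by norm_num)
  obtain ⟨μ, hμ, em⟩ := exists_pow_eq (by positivity : (0 : ℝ) < m) (k := 6) (by norm_num)
  obtain ⟨β, hβ, eB⟩ := exists_pow_eq (by positivity : (0 : ℝ) < B) (k := 3) (by norm_num)
  rw [thresholdR_eq hν hμ.le en em, eB] at h
  rw [boundHR_eq hν.le hμ.le en em, gradBound_eq hν.le hμ.le hβ.le en em eB]
  rcases le_max_iff.1 h with h | h
  · have h1 : β ≤ μ * g / ν := le_of_pow_le_pow_left₀ three_ne_zero (by positivity) h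
    refine max_le ?_ (max_le ?_ ?_)
    · refine le_max_of_le_right (le_max_of_le_left ?_)
      calc ν ^ 6 * β ^ 3 / g ^ 2 ≤ ν ^ 6 * (μ * g / ν) ^ 3 / g ^ 2 := by gcongr
        _ = ν ^ 3 * μ ^ 3 * g := by field_simp
        _ ≤ ν ^ 3 * μ ^ 3 := mul_le_of_le_one_right (by positivity) hg1
    · exact le_max_of_le_right (le_max_left _ _)
    · refine le_max_of_le_right (le_max_of_le_left ?_)
      calc μ ^ 2 * ν ^ 4 * β / g ≤ μ ^ 2 * ν ^ 4 * (μ * g / ν) / g := by gcongr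
        _ = ν ^ 3 * μ ^ 3 := by field_simp
  · have h1 : β ≤ 1 := (pow_le_one_iff_of_nonneg hβ.le three_ne_zero).1 h
    refine max_le_max ?_ (max_le_max le_rfl ?_)
    · gcongr
      exact mul_le_of_le_one_right (by positivity) h
    · refine div_le_div_of_nonneg_right ?_ hg.le
      exact mul_le_of_le_one_right (by positivity) h1

/-- In each minimum, one alternative follows from `1 ≤ B` and the other from `B` being at least half
the threshold. -/
lemma commBound_le_boundKR (hn : 1 ≤ n) (hm : 1 ≤ m) (hB : 1 ≤ B) (hg : 0 < g)
    (h : thresholdR n m g ≤ 2 * B) : commBound n m B g ≤ 2 * boundKR n m g := by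
  obtain ⟨ν, hν, en⟩ := exists_pow_eq (by positivity : (0 : ℝ) < n) (k := 6) (by norm_num)
  obtain ⟨μ, hμ, em⟩ := exists_pow_eq (by positivity : (0 : ℝ) < m) (k := 6) (by norm_num)
  obtain ⟨β, hβ, eB⟩ := exists_pow_eq (by positivity : (0 : ℝ) < B) (k := 3) (by norm_num)
  have hB' : (1 : ℝ) ≤ B := by exact_mod_cast hB
  have hβ3 : 1 ≤ β ^ 3 := eB ▸ hB'
  have hβ1 : 1 ≤ β := (one_le_pow_iff_of_nonneg hβ.le three_ne_zero).1 hβ3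
  rw [thresholdR_eq hν hμ.le en em, eB] at h
  rw [boundKR_eq hν.le hμ.le en em, commBound_eq hν.le hμ.le hβ.le en em eB]
  have h1 := (le_max_left _ _).trans h
  have h2 := le_four_thirds_mul hβ.le h1
  have hpos : 0 < 1 / g ^ 2 := by positivity
  rw [mul_max_of_nonneg _ _ zero_le_two, mul_max_of_nonneg _ _ zero_le_two,
    mul_min_of_nonneg _ _ zero_le_two, mul_min_of_nonneg _ _ zero_le_two]
  refine max_le_max (by linarith) (max_le_max (le_min ?_ ?_) (le_min ?_ ?_))
  · calc μ ^ 3 / (ν ^ 3 * β ^ 3) ≤ μ ^ 3 / ν ^ 3 := by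
          gcongr
          exact le_mul_of_one_le_right (by positivity) hβ3
      _ ≤ 2 * (μ ^ 3 / ν ^ 3) := le_mul_of_one_le_left (by positivity) one_le_two
  · rw [mul_one_div, div_le_div_iff₀ (by positivity) (by positivity)]
    rw [div_pow, div_le_iff₀ (by positivity), mul_pow] at h1
    linarith
  · calc μ ^ 2 / (ν ^ 2 * β ^ 2 * g) ≤ μ ^ 2 / (ν ^ 2 * g) := by
          gcongr
          exact le_mul_of_one_le_right (by positivity) (one_le_pow₀ hβ1)
      _ ≤ 2 * (μ ^ 2 / (ν ^ 2 * g)) := le_mul_of_one_le_left (by positivity) one_le_two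
  · have h3 : (μ * g / ν) ^ 2 ≤ 2 * β ^ 2 := by
      calc (μ * g / ν) ^ 2 ≤ (4 / 3 * β) ^ 2 := by gcongr
        _ ≤ 2 * β ^ 2 := by nlinarith [sq_nonneg β]
    rw [mul_one_div, div_le_div_iff₀ (by positivity) (by positivity)]
    rw [div_pow, div_le_iff₀ (by positivity), mul_pow] at h3
    have h4 := mul_le_mul_of_nonneg_right h3 hg.le
    linarith

lemma boundKC_le_commBound : boundKC g ≤ commBound n m B g := le_max_left _ _

/-- At `B = m^{1/2} n^{-1/2} g^{3/2}` the third term of `commBound` equals `1 / g²` and the second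
is smaller; both decrease in `B`. -/
lemma commBound_eq_boundKC (hn : 1 ≤ n) (hm : 1 ≤ m) (hB : 1 ≤ B) (hg : 0 < g) (hg1 : g ≤ 1)
    (h : thresholdC n m g ≤ B) : commBound n m B g = boundKC g := by
  refine le_antisymm ?_ boundKC_le_commBound
  obtain ⟨ν, hν, en⟩ := exists_pow_eq (by positivity : (0 : ℝ) < n) (k := 6) (by norm_num)
  obtain ⟨μ, hμ, em⟩ := exists_pow_eq (by positivity : (0 : ℝ) < m) (k := 6) (by norm_num)
  obtain ⟨β, hβ, eB⟩ := exists_pow_eq (by positivity : (0 : ℝ) < B) (k := 3) (by norm_num)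
  obtain ⟨γ, hγ, eg⟩ := exists_pow_eq hg (k := 2) (by norm_num)
  rw [thresholdC_eq hν hμ.le hγ.le en em eg, eB] at h
  have h1 : μ * γ / ν ≤ β :=
    le_of_pow_le_pow_left₀ three_ne_zero hβ.le ((le_max_left _ _).trans h)
  have hγ1 : γ ≤ 1 := (pow_le_one_iff_of_nonneg hγ.le two_ne_zero).1 (eg ▸ hg1)
  rw [div_le_iff₀ hν] at h1
  rw [commBound_eq hν.le hμ.le hβ.le en em eB, boundKC, eg]
  refine max_le le_rfl (max_le ?_ ?_)
  · rw [div_le_div_iff₀ (by positivity) (by positivity)]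
    calc μ ^ 3 * (γ ^ 2) ^ 2 = (μ * γ) ^ 3 * γ := by ring
      _ ≤ (β * ν) ^ 3 * 1 := by gcongr
      _ = 1 * (ν ^ 3 * β ^ 3) := by ring
  · rw [div_le_div_iff₀ (by positivity) (by positivity)]
    calc μ ^ 2 * (γ ^ 2) ^ 2 = (μ * γ) ^ 2 * γ ^ 2 := by ring
      _ ≤ (β * ν) ^ 2 * γ ^ 2 := by gcongr
      _ = 1 * (ν ^ 2 * β ^ 2 * γ ^ 2) := by ring

/-- If the power of `m / n` realizes the threshold, the terms with `B` are absorbed by `N^{1/2} /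
g^{1/2}`; if the threshold is 1, then `B ≤ 2` and they match the outer terms of `boundHC`. -/
lemma gradBound_le_boundHC (hn : 1 ≤ n) (hm : 1 ≤ m) (hB : 1 ≤ B) (hg : 0 < g) (hg1 : g ≤ 1)
    (h : (B : ℝ) ≤ 2 * thresholdC n m g) : gradBound n m B g ≤ 2 * boundHC n m g := by
  obtain ⟨ν, hν, en⟩ := exists_pow_eq (by positivity : (0 : ℝ) < n) (k := 6) (by norm_num)
  obtain ⟨μ, hμ, em⟩ := exists_pow_eq (by positivity : (0 : ℝ) < m) (k := 6) (by norm_num)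
  obtain ⟨β, hβ, eB⟩ := exists_pow_eq (by positivity : (0 : ℝ) < B) (k := 3) (by norm_num)
  obtain ⟨γ, hγ, eg⟩ := exists_pow_eq hg (k := 2) (by norm_num)
  have hγ1 : γ ≤ 1 := (pow_le_one_iff_of_nonneg hγ.le two_ne_zero).1 (eg ▸ hg1)
  rw [thresholdC_eq hν hμ.le hγ.le en em eg, eB, mul_max_of_nonneg _ _ zero_le_two] at h
  rw [boundHC_eq hν.le hμ.le hγ.le en em eg, gradBound_eq hν.le hμ.le hβ.le en em eB, eg]
  have hmid : ν ^ 3 * μ ^ 3 ≤ 2 * max (ν ^ 6 / γ ^ 4)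
      (max (ν ^ 3 * μ ^ 3 / γ) (μ ^ 2 * ν ^ 4 / γ ^ 2)) := by
    have h1 : ν ^ 3 * μ ^ 3 ≤ ν ^ 3 * μ ^ 3 / γ := by
      rw [le_div_iff₀ hγ]
      exact mul_le_of_le_one_right (by positivity) hγ1
    have h2 : ν ^ 3 * μ ^ 3 / γ ≤ max (ν ^ 6 / γ ^ 4)
      (max (ν ^ 3 * μ ^ 3 / γ) (μ ^ 2 * ν ^ 4 / γ ^ 2)) :=
      le_max_of_le_right (le_max_left _ _)
    have h3 : 0 < ν ^ 3 * μ ^ 3 / γ := by positivity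
    linarith
  refine max_le ?_ (max_le hmid ?_)
  · rw [mul_max_of_nonneg _ _ zero_le_two, mul_max_of_nonneg _ _ zero_le_two]
    rcases le_max_iff.1 h with h | h
    · refine le_max_of_le_right (le_max_of_le_left ?_)
      calc ν ^ 6 * β ^ 3 / (γ ^ 2) ^ 2 ≤ ν ^ 6 * (2 * (μ * γ / ν) ^ 3) / (γ ^ 2) ^ 2 := by gcongr
        _ = 2 * (ν ^ 3 * μ ^ 3 / γ) := by field_simp
    · refine le_max_of_le_left ?_
      calc ν ^ 6 * β ^ 3 / (γ ^ 2) ^ 2 ≤ ν ^ 6 * (2 * 1) / (γ ^ 2) ^ 2 := by gcongr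
        _ = 2 * (ν ^ 6 / γ ^ 4) := by ring
  · rw [mul_max_of_nonneg _ _ zero_le_two, mul_max_of_nonneg _ _ zero_le_two]
    rcases le_max_iff.1 h with h | h
    · refine le_max_of_le_right (le_max_of_le_left ?_)
      have h1 := le_four_thirds_mul (by positivity) h
      calc μ ^ 2 * ν ^ 4 * β / γ ^ 2 ≤ μ ^ 2 * ν ^ 4 * (4 / 3 * (μ * γ / ν)) / γ ^ 2 := by gcongr
        _ = 4 / 3 * (ν ^ 3 * μ ^ 3 / γ) := by field_simp
        _ ≤ 2 * (ν ^ 3 * μ ^ 3 / γ) := by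
          gcongr
          norm_num
    · refine le_max_of_le_right (le_max_of_le_right ?_)
      have h1 := le_four_thirds_mul zero_le_one (h.trans (by norm_num : (2 : ℝ) * 1 ≤ 2 * 1 ^ 3))
      calc μ ^ 2 * ν ^ 4 * β / γ ^ 2 ≤ μ ^ 2 * ν ^ 4 * (4 / 3 * 1) / γ ^ 2 := by gcongr
        _ = 4 / 3 * (μ ^ 2 * ν ^ 4 / γ ^ 2) := by ring
        _ ≤ 2 * (μ ^ 2 * ν ^ 4 / γ ^ 2) := by
          gcongr
          norm_num

lemma gradBound_eq_mul_commBound (hn : 1 ≤ n) (hm : 1 ≤ m) (hB : 1 ≤ B) (hg : 0 < g) :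
    gradBound n m B g = n * B * commBound n m B g := by
  obtain ⟨ν, hν, en⟩ := exists_pow_eq (by positivity : (0 : ℝ) < n) (k := 6) (by norm_num)
  obtain ⟨μ, hμ, em⟩ := exists_pow_eq (by positivity : (0 : ℝ) < m) (k := 6) (by norm_num)
  obtain ⟨β, hβ, eB⟩ := exists_pow_eq (by positivity : (0 : ℝ) < B) (k := 3) (by norm_num)
  rw [commBound_eq hν.le hμ.le hβ.le en em eB, gradBound_eq hν.le hμ.le hβ.le en em eB, en, eB,
    mul_max_of_nonneg _ _ (by positivity), mul_max_of_nonneg _ _ (by positivity)]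
  congr 1
  · ring
  · congr 1 <;> field_simp

lemma commBound_pos (hg : 0 < g) : 0 < commBound n m B g :=
  lt_of_lt_of_le (by positivity) (le_max_left (1 / g ^ 2) _)

/-- The step-size scale is the inverse of the factor in the communication complexity. -/
lemma one_le_stepScale_mul_commBound {L : ℝ} (hn : 1 ≤ n) (hm : 1 ≤ m) (hB : 1 ≤ B)
    (hg : 0 < g) (hL : 0 < L) : 1 ≤ stepScale n m B g L * L * commBound n m B g := by
  obtain ⟨ν, hν, en⟩ := exists_pow_eq (by positivity : (0 : ℝ) < n) (k := 6) (by norm_num)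
  obtain ⟨μ, hμ, em⟩ := exists_pow_eq (by positivity : (0 : ℝ) < m) (k := 6) (by norm_num)
  obtain ⟨β, hβ, eB⟩ := exists_pow_eq (by positivity : (0 : ℝ) < B) (k := 3) (by norm_num)
  have hL' : ∀ x, x * (1 / L) * L = x := fun x => by field_simp
  rw [commBound_eq hν.le hμ.le hβ.le en em eB, stepScale_eq hν.le hμ.le hβ.le en em eB, hL']
  rcases min_choice (g ^ 2) (min (ν ^ 3 * β ^ 3 / μ ^ 3) (ν ^ 2 * β ^ 2 * g / μ ^ 2)) with h | h
  · rw [h]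
    calc 1 = g ^ 2 * (1 / g ^ 2) := by field_simp
      _ ≤ _ := by
        gcongr
        exact le_max_left _ _
  · rw [h]
    rcases min_choice (ν ^ 3 * β ^ 3 / μ ^ 3) (ν ^ 2 * β ^ 2 * g / μ ^ 2) with h | h
    · rw [h]
      calc 1 = ν ^ 3 * β ^ 3 / μ ^ 3 * (μ ^ 3 / (ν ^ 3 * β ^ 3)) := by field_simp
        _ ≤ _ := by
          gcongr
          exact le_max_of_le_right (le_max_left _ _)
    · rw [h]
      calc 1 = ν ^ 2 * β ^ 2 * g / μ ^ 2 * (μ ^ 2 / (ν ^ 2 * β ^ 2 * g)) := by field_simp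
        _ ≤ _ := by
          gcongr
          exact le_max_of_le_right (le_max_right _ _)

/-- What a step-size of the order `stepScale` satisfies. -/
lemma stepScale_bounds {L α a : ℝ} (hn : 1 ≤ n) (hm : 1 ≤ m) (hB : 1 ≤ B) (hg : 0 < g)
    (hL : 0 < L) (hα : 0 ≤ α) (ha : 0 ≤ a) (h : α ≤ a * stepScale n m B g L) :
    α * L ≤ a * g ^ 2 ∧ (α * L) ^ 2 ≤ a ^ 2 * (n * B ^ 2 / m) ∧
      (α * L) ^ 3 ≤ a ^ 3 * (n * B ^ 2 / m) * g ^ 3 := by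
  obtain ⟨ν, hν, en⟩ := exists_pow_eq (by positivity : (0 : ℝ) < n) (k := 6) (by norm_num)
  obtain ⟨μ, hμ, em⟩ := exists_pow_eq (by positivity : (0 : ℝ) < m) (k := 6) (by norm_num)
  obtain ⟨β, hβ, eB⟩ := exists_pow_eq (by positivity : (0 : ℝ) < B) (k := 3) (by norm_num)
  rw [stepScale_eq hν.le hμ.le hβ.le en em eB, ← mul_assoc, mul_one_div, le_div_iff₀ hL] at h
  have h1 := h.trans (mul_le_mul_of_nonneg_left (min_le_left _ _) ha)
  have h2 := h.trans (mul_le_mul_of_nonneg_left ((min_le_right _ _).trans (min_le_left _ _)) ha)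
  have h3 := h.trans (mul_le_mul_of_nonneg_left ((min_le_right _ _).trans (min_le_right _ _)) ha)
  have hαL : 0 ≤ α * L := by positivity
  refine ⟨h1, ?_, ?_⟩
  · refine (pow_le_pow_left₀ hαL h2 2).trans (le_of_eq ?_)
    rw [en, em, eB]
    field_simp
  · refine (pow_le_pow_left₀ hαL h3 3).trans (le_of_eq ?_)
    rw [en, em, eB]
    field_simp

end Bounds

/-! ### The convergence rate -/

section Rate

/-- Admissible coefficients for small step-sizes. -/
lemma exists_isAdmissible {n B q : ℕ} {L α g : ℝ} (hn : 1 ≤ n) (hB : 1 ≤ B)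
    (hL : 0 < L) (hα : 0 < α) (hg : 0 < g) (hg1 : g ≤ 1)
    (h1 : 108 * (α * L) ^ 2 ≤ g ^ 4)
    (h2 : (α * L) ^ 2 * (8 + 24 * (q / (n * B))) ≤ 1)
    (h3 : (α * L) ^ 3 * (6 + 18 * (q / (n * B))) ≤ g ^ 3) :
    ∃ cX cY cZ : ℝ, IsAdmissible n B q L α g cX cY cZ ∧ 2 * cY * n ≤ 2 / L := by
  have hn' : (0 : ℝ) < n := by positivity
  have hB' : (0 : ℝ) < B := by positivity
  set Q : ℝ := q / (n * B) with hQ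
  have hQ0 : 0 ≤ Q := by positivity
  -- The conditions on the coefficients are circular: `cZ` needs `cY`, `cY` needs `cX + 3 * cZ`, and
  -- `cX` needs `cZ`. The number `K` is an a priori bound for `9 * cZ + 3 * u`, hence for `(cX + 3 *
  -- cZ) * g`. By `h1` the feedback of `K` into `9 * cZ` is at most `K / 2`, so `K` can be twice `3
  -- * u + 9 * u * Q`.
  set u : ℝ := α * (L ^ 2 / n) with hu
  have hu0 : 0 < u := by positivity
  set K : ℝ := u * (6 + 18 * Q) with hK
  have hK0 : 0 < K := by positivity
  set cY : ℝ := K * α ^ 2 / g ^ 3 with hcY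
  have hcY0 : 0 < cY := by positivity
  set cZ : ℝ := u * Q + 6 * K * (α * L) ^ 2 / g ^ 4 with hcZ
  have hcZ0 : 0 < cZ := by positivity
  set cX : ℝ := (6 * cZ + 3 * u) / g with hcX
  have hcX0 : 0 < cX := by positivity
  have hcXg : cX * g = 6 * cZ + 3 * u := div_mul_cancel₀ _ hg.ne'
  have hcZK : 9 * cZ + 3 * u ≤ K := by
    have e : 6 * K * (α * L) ^ 2 / g ^ 4 ≤ K / 18 := by
      rw [div_le_iff₀ (by positivity)]
      nlinarith
    have : K = 6 * u + 18 * (u * Q) := by rw [hK]; ring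
    linarith
  refine ⟨cX, cY, cZ, ⟨hα.le, hcX0.le, hcY0.le, hcZ0.le, ?_, ?_, ?_, ?_⟩, ?_⟩
  · nlinarith [mul_pos hcZ0 hg]
  · have e1 : cY * g = K / g * (α ^ 2 / g) := by
      rw [hcY]
      field_simp
    rw [e1]
    refine mul_le_mul_of_nonneg_right ?_ (by positivity)
    rw [le_div_iff₀ hg]
    nlinarith
  · have e1 : 3 * n * α ^ 2 * cZ ≤ 3 * n * α ^ 2 * (K / 9) := by
      gcongr
      linarith
    have e2 : 3 * n * α ^ 2 * (K / 9) = α / 4 * ((α * L) ^ 2 * (8 + 24 * Q)) := by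
      rw [hK, hu]
      field_simp
      ring
    have e3 := mul_le_mul_of_nonneg_left h2 (by positivity : 0 ≤ α / 4)
    have e4 : α * L ≤ 1 / 2 := by
      have : (α * L) ^ 2 ≤ (1 / 2) ^ 2 := by
        have : 0 ≤ (α * L) ^ 2 * Q := by positivity
        nlinarith
      exact le_of_pow_le_pow_left₀ two_ne_zero (by norm_num) this
    have e5 : α / 4 ≤ α / 2 * (1 - α * L) := by nlinarith
    linarith
  · refine le_of_eq ?_
    rw [hcZ, hcY, hu, hQ]
    field_simp
  · have e : 2 * cY * n = 2 / L * ((α * L) ^ 3 * (6 + 18 * Q) / g ^ 3) := by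
      rw [hcY, hK, hu]
      field_simp
    rw [e]
    refine mul_le_of_le_one_right (by positivity) ?_
    rw [div_le_one (by positivity)]
    exact h3

/-- The conditions of `exists_isAdmissible`, for a step-size of the order `stepScale`. -/
lemma step_conditions {a c g x Q r : ℝ} (hx : 0 ≤ x) (hg : 0 < g) (hg1 : g ≤ 1) (ha : 0 ≤ a)
    (ha1 : a ≤ 1 / 16) (hac : a * c ≤ 1 / 16) (hQ : 0 ≤ Q) (hQr : Q * r ≤ c)
    (b1 : x ≤ a * g ^ 2) (b2 : x ^ 2 ≤ a ^ 2 * r) (b3 : x ^ 3 ≤ a ^ 3 * r * g ^ 3) :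
    108 * x ^ 2 ≤ g ^ 4 ∧ x ^ 2 * (8 + 24 * Q) ≤ 1 ∧ x ^ 3 * (6 + 18 * Q) ≤ g ^ 3 := by
  -- In the application `x = α L`, `Q = q / (n B)` and `r = n B² / m`, so that `Q * r = q B / m` is
  -- bounded by `c₂`.
  have hxg2 : x ≤ 1 / 16 * g ^ 2 := b1.trans (by gcongr)
  have hxg : x ≤ 1 / 16 * g := hxg2.trans (by nlinarith)
  have hx1 : x ≤ 1 / 16 := hxg.trans (by linarith)
  refine ⟨?_, ?_, ?_⟩
  · have h := pow_le_pow_left₀ hx hxg2 2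
    have e : (1 / 16 * g ^ 2) ^ 2 = 1 / 256 * g ^ 4 := by ring
    have : 0 < g ^ 4 := by positivity
    linarith
  · have h1 := pow_le_pow_left₀ hx hx1 2
    have h2 : x ^ 2 * Q ≤ 1 / 256 := by
      calc x ^ 2 * Q ≤ a ^ 2 * r * Q := by gcongr
        _ = a ^ 2 * (Q * r) := by ring
        _ ≤ a ^ 2 * c := by gcongr
        _ = a * (a * c) := by ring
        _ ≤ a * (1 / 16) := by gcongr
        _ ≤ 1 / 256 := by linarith
    linarith
  · have hg3 : 0 < g ^ 3 := by positivity
    have h1 := pow_le_pow_left₀ hx hxg 3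
    have e : (1 / 16 * g) ^ 3 = 1 / 4096 * g ^ 3 := by ring
    have h2 : x ^ 3 * Q ≤ 1 / 4096 * g ^ 3 := by
      calc x ^ 3 * Q ≤ a ^ 3 * r * g ^ 3 * Q := by gcongr
        _ = a ^ 3 * g ^ 3 * (Q * r) := by ring
        _ ≤ a ^ 3 * g ^ 3 * c := by gcongr
        _ = a ^ 2 * (a * c) * g ^ 3 := by ring
        _ ≤ a ^ 2 * (1 / 16) * g ^ 3 := by gcongr
        _ ≤ (1 / 16) ^ 2 * (1 / 16) * g ^ 3 := by gcongr
        _ = 1 / 4096 * g ^ 3 := by norm_num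
    linarith

variable {Ω : Type*} [MeasurableSpace Ω] {μ : Measure Ω} [IsProbabilityMeasure μ]
  {n m p B q : ℕ} {f : Fin n → Fin m → E p → ℝ} {L : ℝ} {G : Digraph (Fin n)}
  {W : Matrix (Fin n) (Fin n) ℝ} {α : ℝ} {x₀ : E p}
  {τ : ℕ → ℕ → Fin n → Fin B → Ω → Fin m}

lemma SmoothCosts.initialGap_nonneg (hf : SmoothCosts f L) (x₀ : E p) : 0 ≤ initialGap f L x₀ := by
  have h := ciInf_le hf.bddBelow x₀
  have h2 : 0 ≤ L * (globalCost f x₀ - ⨅ x, globalCost f x) := mul_nonneg hf.pos.le (by linarith)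
  have h3 : 0 ≤ (1 / (n : ℝ)) * ∑ i, ‖gradient (localCost f i) x₀‖ ^ 2 := by positivity
  exact add_nonneg h2 h3

/-- The number of iterations that suffices for small step-sizes. -/
lemma findsIn_of_le (hf : SmoothCosts f L) (hn : 1 ≤ n) (hm : 1 ≤ m) (hB : 1 ≤ B)
    (hW : IsWeightMatrix G W) (hτ : IsUniformSampling μ q τ) (hα : 0 < α)
    (h1 : 108 * (α * L) ^ 2 ≤ (1 - mixing W) ^ 4)
    (h2 : (α * L) ^ 2 * (8 + 24 * (q / (n * B))) ≤ 1)
    (h3 : (α * L) ^ 3 * (6 + 18 * (q / (n * B))) ≤ (1 - mixing W) ^ 3) {ε : ℝ} {S : ℕ}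
    (hS : 1 ≤ S) (h : 8 * initialGap f L x₀ ≤ α * L * (S * (q + 1)) * ε ^ 2) :
    FindsIn f W L α q x₀ μ τ ε S := by
  have hL := hf.pos
  have hlt := mixing_lt_one hn hW
  have hn' : (0 : ℝ) < n := by positivity
  have hS' : (0 : ℝ) < S := by positivity
  obtain ⟨cX, cY, cZ, hc, hcY⟩ := exists_isAdmissible hn hB hL hα (by linarith)
    (by linarith [mixing_nonneg W]) h1 h2 h3
  obtain ⟨S, rfl⟩ : ∃ S', S = S' + 1 := ⟨S - 1, by omega⟩
  have hsum := sum_integral_avgGap_le (x₀ := x₀) hf hn hm hB hW.doublyStochastic hlt hc hτ S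
  refine findsIn_of_sum_le hm hτ ?_
  set A := ∑ s ∈ Finset.range (S + 1), ∑ t ∈ Finset.range (q + 1),
        ∫ ω, avgGap f L (stateAt f W α q x₀ (samplePath τ ω) s t) ∂μ
  set Γ := ∑ i, ‖gradient (localCost f i) x₀‖ ^ 2 with hΓ
  have hΓ0 : 0 ≤ Γ := Finset.sum_nonneg fun _ _ => by positivity
  have hI : initialGap f L x₀
      = L * (globalCost f x₀ - ⨅ x, globalCost f x) + 1 / (n : ℝ) * Γ := rfl
  have k1 : 2 * cY * Γ ≤ 2 / L * (1 / n * Γ) := by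
    have := mul_le_mul_of_nonneg_right hcY (by positivity : 0 ≤ 1 / (n : ℝ) * Γ)
    have e : 2 * cY * n * (1 / n * Γ) = 2 * cY * Γ := by field_simp
    linarith
  have k2 : 2 / L * initialGap f L x₀ = 2 * (globalCost f x₀ - ⨅ x, globalCost f x)
      + 2 / L * (1 / n * Γ) := by
    rw [hI]
    field_simp
  have k3 : 0 ≤ globalCost f x₀ - ⨅ x, globalCost f x := by
    linarith [ciInf_le hf.bddBelow x₀]
  have k4 : α / 4 * A ≤ 2 / L * initialGap f L x₀ := by linarith
  have k5 : α * L * A ≤ 8 * initialGap f L x₀ := by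
    have := mul_le_mul_of_nonneg_left k4 (by positivity : 0 ≤ 4 * L)
    have e : 4 * L * (2 / L * initialGap f L x₀) = 8 * initialGap f L x₀ := by field_simp; ring
    linarith
  have hαL : 0 < α * L := by positivity
  rw [one_div_mul_eq_div, div_le_iff₀ (by positivity)]
  refine le_of_mul_le_mul_left ?_ hαL
  linarith

/-- The complexity, when every number of outer loops with half the resource suffices. -/
lemma complexityAtMost_of_half {finds : ℕ → Prop} {cost : ℕ → ℕ} {c : ℕ} {T : ℝ}
    (hcost : ∀ S, cost S = S * c) (hc : 1 ≤ c)
    (h : ∀ S, 1 ≤ S → T ≤ 2 * cost S → finds S) : ComplexityAtMost finds cost T := by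
  refine ⟨fun S hS hTS => h S hS (hTS.trans ?_), ?_⟩
  · have : (0 : ℝ) ≤ cost S := by positivity
    linarith
  have hc' : (0 : ℝ) < c := by positivity
  -- If one loop already covers `T`, it is enough. Otherwise `⌊T / c⌋₊` loops cost at most `T` and
  -- at least `T / 2`, as `x ≤ 2 ⌊x⌋` for `x ≥ 1`.
  rcases le_total T c with hTc | hTc
  · refine ⟨1, le_rfl, h 1 le_rfl ?_, le_max_right _ _⟩
    rw [hcost, one_mul]
    linarith
  · have h1 : 1 ≤ T / c := (one_le_div hc').2 hTc
    have h2 : 1 ≤ ⌊T / c⌋₊ := (Nat.one_le_floor_iff _).2 h1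
    have h2' : (1 : ℝ) ≤ ⌊T / c⌋₊ := by exact_mod_cast h2
    have h3 := Nat.lt_floor_add_one (T / c)
    have h4 := Nat.floor_le (zero_le_one.trans h1)
    refine ⟨⌊T / c⌋₊, h2, h _ h2 ?_, le_max_of_le_left ?_⟩
    · rw [hcost, Nat.cast_mul]
      rw [div_lt_iff₀ hc'] at h3
      nlinarith
    · rw [hcost, Nat.cast_mul]
      rwa [le_div_iff₀ hc'] at h4

/-- The complexity in a resource of which an iteration uses at most `w`, when `8 k D / a`
iterations suffice. -/
lemma complexityAtMost_of_rate {finds : ℕ → Prop} {cost : ℕ → ℕ} {c q : ℕ}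
    {a k w D ρ bound : ℝ} (ha : 0 < a) (hD : 0 ≤ D) (hw : 0 < w)
    (hfind : ∀ S : ℕ, 1 ≤ S → 8 * k * D ≤ a * (S * (q + 1)) → finds S)
    (hcost : ∀ S, cost S = S * c) (hc : 1 ≤ c) (hcw : (c : ℝ) ≤ w * (q + 1))
    (hwk : w * k ≤ 2 * ρ * bound) :
    ComplexityAtMost finds cost (32 * ρ / a * (bound * D)) := by
  refine complexityAtMost_of_half hcost hc fun S hS h => hfind S hS ?_
  rw [hcost, Nat.cast_mul, div_mul_eq_mul_div, div_le_iff₀ ha] at h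
  have k1 := mul_le_mul_of_nonneg_right hwk (by positivity : 0 ≤ 8 * D)
  have k2 := mul_le_mul_of_nonneg_left hcw (by positivity : 0 ≤ (S : ℝ) * a)
  refine le_of_mul_le_mul_left ?_ hw
  linarith

/-- The inner loop is long enough to amortize the full gradients: `m ≤ q B / c₁`. -/
lemma gradCost_one_le {n m B q : ℕ} {c₁ : ℝ} (hc₁ : 0 < c₁) (hB : 1 ≤ B)
    (hq : c₁ * (m / B) ≤ q) :
    ((n * (m + 2 * q * B) : ℕ) : ℝ) ≤ n * B * (2 + 1 / c₁) * (q + 1) := by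
  have hB' : (0 : ℝ) < B := by positivity
  have hmq : (m : ℝ) ≤ 1 / c₁ * (q * B) := by
    rw [← mul_div_assoc, div_le_iff₀ hB'] at hq
    rw [one_div_mul_eq_div, le_div_iff₀ hc₁]
    linarith
  have k1 := mul_le_mul_of_nonneg_left hmq (Nat.cast_nonneg n : (0 : ℝ) ≤ n)
  have k2 : 0 ≤ n * B * (2 + 1 / c₁) := by positivity
  push_cast
  linarith

end Rate

end GTSarah

/-! ### Choice of the constants and the four complexity bounds -/

theorem corollary3p6
    -- The universal constants behind `q = O(m/B)`.
    (c₁ c₂ : ℝ) (hc₁ : 0 < c₁) (hc₁₂ : c₁ ≤ c₂) :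
    -- The step-size is of the order `stepScale`, with a small enough universal constant.
    ∃ a₀ : ℝ, 0 < a₀ ∧ ∀ a₁ : ℝ, 0 < a₁ → a₁ ≤ a₀ →
    -- The universal constant behind the complexities.
    ∃ K : ℝ, 0 < K ∧
    ∀ (n m p B q : ℕ), 1 ≤ n → 1 ≤ m → 1 ≤ B → B ≤ m → 1 ≤ q →
    ∀ (f : Fin n → Fin m → E p → ℝ) (L : ℝ), SmoothCosts f L →
    ∀ (G : Digraph (Fin n)) (W : Matrix (Fin n) (Fin n) ℝ), IsWeightMatrix G W →
    ∀ {Ω : Type*} [MeasurableSpace Ω] (μ : MeasureTheory.Measure Ω)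
      [MeasureTheory.IsProbabilityMeasure μ]
      (τ : ℕ → ℕ → Fin n → Fin B → Ω → Fin m), IsUniformSampling μ q τ →
    ∀ (x₀ : E p) (α ε : ℝ), 0 < ε →
    c₁ * (m / B) ≤ q → (q : ℝ) ≤ c₂ * (m / B) →
    a₁ * stepScale n m B (1 - mixing W) L ≤ α → α ≤ a₀ * stepScale n m B (1 - mixing W) L →
    -- (i)
    (B ≤ ⌊thresholdR n m (1 - mixing W)⌋₊ →
      ComplexityAtMost (FindsIn f W L α q x₀ μ τ ε) (gradCost n m q B)
        (K * (boundHR n m (1 - mixing W) * (initialGap f L x₀ / ε ^ 2))) ∧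
      -- the best possible bound among all minibatch sizes
      gradBound n m B (1 - mixing W) = boundHR n m (1 - mixing W) ∧
      (∀ B' : ℕ, 1 ≤ B' → B' ≤ m →
        boundHR n m (1 - mixing W) ≤ gradBound n m B' (1 - mixing W))) ∧
    (B = ⌊thresholdR n m (1 - mixing W)⌋₊ →
      ComplexityAtMost (FindsIn f W L α q x₀ μ τ ε) (commCost q)
        (K * (boundKR n m (1 - mixing W) * (initialGap f L x₀ / ε ^ 2)))) ∧
    -- (ii)
    (⌈thresholdC n m (1 - mixing W)⌉₊ ≤ B →
      ComplexityAtMost (FindsIn f W L α q x₀ μ τ ε) (commCost q)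
        (K * (boundKC (1 - mixing W) * (initialGap f L x₀ / ε ^ 2))) ∧
      -- the best possible bound among all minibatch sizes
      commBound n m B (1 - mixing W) = boundKC (1 - mixing W) ∧
      (∀ B' : ℕ, 1 ≤ B' → B' ≤ m →
        boundKC (1 - mixing W) ≤ commBound n m B' (1 - mixing W))) ∧
    (B = ⌈thresholdC n m (1 - mixing W)⌉₊ →
      ComplexityAtMost (FindsIn f W L α q x₀ μ τ ε) (gradCost n m q B)
        (K * (boundHC n m (1 - mixing W) * (initialGap f L x₀ / ε ^ 2)))) := by
  have hc₂ : 0 < c₂ := hc₁.trans_le hc₁₂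
  -- Makes both `a₀` and `a₀ * c₂` at most `1 / 16`, as `step_conditions` asks.
  set a₀ : ℝ := 1 / (16 * (1 + c₂)) with ha₀def
  have ha₀ : 0 < a₀ := by positivity
  have ha₀c : a₀ * (1 + c₂) = 1 / 16 := by
    rw [ha₀def]
    field_simp
  refine ⟨a₀, ha₀, fun a₁ ha₁ _ => ?_⟩
  set ρ : ℝ := 2 + 1 / c₁ with hρ
  have hρ1 : 1 ≤ ρ := by
    have : 0 < 1 / c₁ := by positivity
    linarith
  -- The constant 32 is 8 from the convergence rate, 2 from rounding the batch size, and 2 from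
  -- rounding the number of loops; `ρ` is the gradient cost of an iteration in units of `n B`.
  refine ⟨32 * ρ / a₁, by positivity, ?_⟩
  intro n m p B q hn hm hB hBm hq f L hf G W hW Ω _ μ _ τ hτ x₀ α ε hε hq1 hq2 hα1 hα2
  have hlt := mixing_lt_one hn hW
  have hlam := mixing_nonneg W
  set g := 1 - mixing W with hgdef
  have hg : 0 < g := by linarith
  have hg1 : g ≤ 1 := by linarith
  have hL := hf.pos
  have hn' : (0 : ℝ) < n := by positivity
  have hm' : (0 : ℝ) < m := by positivity
  have hB' : (0 : ℝ) < B := by positivity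
  have hΔ := hf.initialGap_nonneg x₀
  set Δ := initialGap f L x₀
  set k := commBound n m B g with hk
  have hkpos : 0 < k := commBound_pos hg
  have hone := one_le_stepScale_mul_commBound hn hm hB hg hL
  have hscale : 0 < stepScale n m B g L := by
    by_contra! hneg
    have : stepScale n m B g L * (L * commBound n m B g) ≤ 0 :=
      mul_nonpos_of_nonpos_of_nonneg hneg (by positivity)
    linarith
  have hα : 0 < α := lt_of_lt_of_le (by positivity) hα1
  have hαk : a₁ ≤ α * L * k := by
    calc a₁ ≤ a₁ * (stepScale n m B g L * L * k) := le_mul_of_one_le_right ha₁.le hone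
      _ = a₁ * stepScale n m B g L * L * k := by ring
      _ ≤ α * L * k := by gcongr
  obtain ⟨b1, b2, b3⟩ := stepScale_bounds hn hm hB hg hL hα.le ha₀.le hα2
  have hQr : q / (n * B) * (n * B ^ 2 / m) ≤ c₂ := by
    have : (q : ℝ) * B ≤ c₂ * m := by
      rwa [← mul_div_assoc, le_div_iff₀ hB'] at hq2
    have e : (q : ℝ) / (n * B) * (n * B ^ 2 / m) = q * B / m := by field_simp
    rw [e, div_le_iff₀ hm']
    exact this
  have hQ0 : (0 : ℝ) ≤ q / (n * B) := by positivity
  have hsmall : a₀ ≤ 1 / 16 := by nlinarith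
  have hsmall2 : a₀ * c₂ ≤ 1 / 16 := by nlinarith
  have hαL : 0 < α * L := by positivity
  obtain ⟨h1, h2, h3⟩ := step_conditions hαL.le hg hg1 ha₀.le hsmall hsmall2 hQ0 hQr b1 b2 b3
  have hfind : ∀ S : ℕ, 1 ≤ S → 8 * k * (Δ / ε ^ 2) ≤ a₁ * (S * (q + 1)) →
      FindsIn f W L α q x₀ μ τ ε S := by
    intro S hS h
    refine findsIn_of_le hf hn hm hB hW hτ hα h1 h2 h3 hS ?_
    have hT : 0 ≤ (S : ℝ) * (q + 1) * ε ^ 2 := by positivity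
    rw [← mul_div_assoc, div_le_iff₀ (by positivity)] at h
    have := mul_le_mul_of_nonneg_right hαk hT
    refine le_of_mul_le_mul_left ?_ hkpos
    linarith
  have hD : 0 ≤ Δ / ε ^ 2 := by positivity
  have hcomm : ∀ {bound : ℝ}, 0 ≤ bound → k ≤ 2 * bound →
      ComplexityAtMost (FindsIn f W L α q x₀ μ τ ε) (commCost q)
        (32 * ρ / a₁ * (bound * (Δ / ε ^ 2))) := fun {bound} hbound h => by
    refine complexityAtMost_of_rate ha₁ hD one_pos hfind (c := q + 1) (fun S => rfl)
      (Nat.le_add_left 1 q) (by simp) ?_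
    rw [one_mul, mul_assoc, mul_left_comm]
    exact h.trans (le_mul_of_one_le_left (by positivity) hρ1)
  have hgrad : ∀ {bound : ℝ}, gradBound n m B g ≤ 2 * bound →
      ComplexityAtMost (FindsIn f W L α q x₀ μ τ ε) (gradCost n m q B)
        (32 * ρ / a₁ * (bound * (Δ / ε ^ 2))) := fun {bound} h => by
    rw [gradBound_eq_mul_commBound hn hm hB hg] at h
    refine complexityAtMost_of_rate ha₁ hD (w := n * B * ρ) (by positivity) hfind
      (fun S => rfl) (Nat.mul_pos hn (Nat.add_pos_left hm _)) (gradCost_one_le hc₁ hB hq1) ?_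
    calc n * B * ρ * k = ρ * (n * B * k) := by ring
      _ ≤ ρ * (2 * bound) := by gcongr
      _ = 2 * ρ * bound := by ring
  have hthR : 1 ≤ thresholdR n m g := le_max_right _ _
  have hthC : 1 ≤ thresholdC n m g := le_max_right _ _
  have hHR : 0 ≤ boundHR n m g := le_max_of_le_left (by positivity)
  have hKR : 0 ≤ boundKR n m g := le_max_of_le_left (by positivity)
  have hKC : 0 ≤ boundKC g := by
    rw [boundKC]
    positivity
  refine ⟨fun hBR => ?_, fun hBR => ?_, fun hBC => ?_, fun hBC => ?_⟩
  · have h := gradBound_le_boundHR hn hm hB hg hg1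
      ((Nat.cast_le.2 hBR).trans (Nat.floor_le (by linarith)))
    exact ⟨hgrad (by linarith), le_antisymm h (boundHR_le_gradBound hn hm hB hg),
      fun B' hB' _ => boundHR_le_gradBound hn hm hB' hg⟩
  · refine hcomm hKR (commBound_le_boundKR hn hm hB hg ?_)
    -- Rounding down at most halves the threshold: it is below `B + 1 ≤ 2 * B`.
    have h4 := Nat.lt_floor_add_one (thresholdR n m g)
    rw [← hBR] at h4
    have h5 : (1 : ℝ) ≤ B := by exact_mod_cast hB
    linarith
  · have h := commBound_eq_boundKC hn hm hB hg hg1 ((Nat.le_ceil _).trans (Nat.cast_le.2 hBC))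
    exact ⟨hcomm hKC (by linarith), h, fun B' _ _ => boundKC_le_commBound⟩
  · refine hgrad (gradBound_le_boundHC hn hm hB hg hg1 ?_)
    -- Rounding up at most doubles the threshold, which is at least 1.
    have h4 := Nat.ceil_lt_add_one (by linarith : 0 ≤ thresholdC n m g)
    rw [← hBC] at h4
    linarith
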